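/- Let $d\ge 1$, let $\beta\in\mathbb{R}$, let $\nu_0$ be a symmetric probability measure on $\mathbb{R}$, and let $\nu$ be the law of couplings $J=(J_{xy})$, indexed by the nearest-neighbour edges $\{x,y\}$ of $\mathbb{Z}^d$, that are i.i.d. with law $\nu_0$. For a box $\Lambda=\prod_i[a_i,b_i]\cap\mathbb{Z}^d$ let $G_{\Lambda,\beta,J}$ be the Edwards–Anderson Gibbs measure on $\{-1,+1\}^\Lambda$ with periodic boundary conditions, $G_{\Lambda,\beta,J}(\sigma)\propto\exp\big(\beta\sum J_{xy}\sigma_x\sigma_y\big)$, where the sum is over all nearest-neighbour edges in $\Lambda$ and the additional edges that join opposite faces of $\Lambda$; the additional edge in direction $e_i$ at a site $x$ with $x_i=b_i$ joins $x$ to $x-(b_i-a_i)e_i$ and carries the coupling $J_{x,x+e_i}$. Let $(\Lambda_n)$ be boxes such that every site of $\mathbb{Z}^d$ is eventually in $\Lambda_n$, and let $J\mapsto\kappa_J$ be a metastate of $(G_{\Lambda_n,\beta,J})_n$: a probability kernel from couplings to the space $\mathcal{M}$ of probability measures on $\{-1,+1\}^{\mathbb{Z}^d}$ such that, along some subsequence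 $(\Lambda_{n_k})$, $$\nu(dJ)\prod_{i\in\mathbb{N}}G_{\Lambda_{n_k},\beta,J}\ \longrightarrow\ \nu(dJ)\int_{\mathcal{M}}\kappa_J(d\Gamma)\prod_{i\in\mathbb{N}}\Gamma$$ in the sense of finite-dimensional distributions, that is, weak convergence of the joint law of any finitely many couplings and of finitely many replicas $\sigma^i$ restricted to any finite window. For $\sigma,\sigma'\in\{-1,+1\}^{\mathbb{Z}^d}$ let $$R(\sigma,\sigma')=\lim_{n\to\infty}\frac{1}{|W_n^*|}\sum_{\{x,y\}\in W_n^*}\sigma_x\sigma_y\sigma'_x\sigma'_y,\qquad W_n=[-n,n]^d\cap\mathbb{Z}^d,$$ whenever the limit exists, where $W^*$ is the set of nearest-neighbour edges with both endpoints in $W$. Then for $\nu$-almost every $J$ the limits $R(\sigma^i,\sigma^j)$, $i,j\in\mathbb{N}$, all exist almost surely under $\int\kappa_J(d\Gamma)\prod_{i}\Gamma$, and the random matrix $Q_J=(R(\sigma^i,\sigma^j))_{i,j\in\mathbb{N}}$ under this measure is a random overlap structure (ROSt): it is almost surely symmetric and positive semidefinite with ones on the diagonal, and its law is invariant under simultaneous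 permutation of finitely many rows and columns. Let $Q$ be the averaged structure, whose law is the average over $\nu(dJ)$ of the law of $Q_J$. Then $Q$ is a ROSt, and $$Q_J\overset{\text{law}}{=}Q\qquad\text{for $\nu$-almost every }J .$$ -/

import Mathlib

open MeasureTheory ProbabilityTheory Filter Topology
open scoped BoundedContinuousFunction

noncomputable section

namespace EdwardsAnderson

/-! ### Lattice, couplings and spins -/

/-- The lattice `ℤ^d`. -/
abbrev Site (d : ℕ) : Type := Fin d → ℤ

/-- Nearest-neighbour edges of `ℤ^d`: the pair `(x, i)` stands for the edge `{x, x + e_i}`. Every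
nearest-neighbour edge is of this form for exactly one `(x, i)`. -/
abbrev Edge (d : ℕ) : Type := Site d × Fin d

/-- Couplings: a real number for every nearest-neighbour edge of `ℤ^d`. -/
abbrev Couplings (d : ℕ) : Type := Edge d → ℝ

/-- Spin configurations `σ ∈ {-1, +1}^{ℤ^d}`; the units of `ℤ` are exactly `-1` and `1`. -/
abbrev Config (d : ℕ) : Type := Site d → ℤˣ

/-- The law `ν` of the couplings: independent, each of law `ν₀`. -/
abbrev couplingLaw (d : ℕ) (ν₀ : Measure ℝ) : Measure (Couplings d) :=
  Measure.infinitePi (fun _ : Edge d => ν₀)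

/-- The two-element space of spin values carries the discrete σ-algebra. -/
instance : MeasurableSingletonClass ℤˣ where
  measurableSet_singleton u :=
    ⟨{(u : ℤ)}, measurableSet_singleton _, by ext v; simp [Units.ext_iff]⟩

/-- The spin at `x` as a real number `±1`. -/
def spin {d : ℕ} (σ : Config d) (x : Site d) : ℝ := ((σ x : ℤ) : ℝ)

/-! ### Finite-volume Gibbs measures with periodic boundary conditions -/

/-- A (nonempty) box of `ℤ^d`, with corners `lo` and `hi`. -/
structure Box (d : ℕ) where
  lo : Site d
  hi : Site d
  lo_le_hi : lo ≤ hi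

/-- The sites of a box: all `x` with `lo ≤ x ≤ hi` coordinatewise. -/
def Box.sites {d : ℕ} (Λ : Box d) : Finset (Site d) := Finset.Icc Λ.lo Λ.hi

/-- The neighbour of `x` in direction `e_i` on the box with periodic boundary conditions:
`x + e_i`, except that on the face `x i = hi i` one continues on the opposite face. -/
def Box.next {d : ℕ} (Λ : Box d) (x : Site d) (i : Fin d) : Site d :=
  Function.update x i (if x i = Λ.hi i then Λ.lo i else x i + 1)

/-- The periodic Hamiltonian `H_{Λ,J}(σ) = - ∑_{x ∈ Λ} ∑_i J_{(x,i)} σ_x σ_{next x i}`. For edges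
with both endpoints in `Λ` this is `J_{x,x+e_i} σ_x σ_{x+e_i}`; an additional edge that joins
opposite faces carries the coupling of the lattice edge that leaves `Λ` at `x` in direction `e_i`,
so that distinct edges of the torus carry distinct couplings. -/
def hamiltonian {d : ℕ} (Λ : Box d) (J : Couplings d) (σ : Config d) : ℝ :=
  -∑ x ∈ Λ.sites, ∑ i, J (x, i) * spin σ x * spin σ (Λ.next x i)

/-- A configuration on the box, seen as a configuration on `ℤ^d` which is `+1` off the box. The
values off the box play no role: only windows contained in the box are ever looked at. -/
def Box.extend {d : ℕ} (Λ : Box d) (τ : Λ.sites → ℤˣ) : Config d :=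
  fun x => if h : x ∈ Λ.sites then τ ⟨x, h⟩ else 1

/-- The partition function `Z = ∑_σ exp (-β H(σ))`. -/
def partitionFunction {d : ℕ} (β : ℝ) (Λ : Box d) (J : Couplings d) : ℝ :=
  ∑ τ : Λ.sites → ℤˣ, Real.exp (-β * hamiltonian Λ J (Λ.extend τ))

/-- The Gibbs weight `exp (-β H(τ)) / Z` of a configuration `τ ∈ {-1, +1}^Λ`. -/
def gibbsWeight {d : ℕ} (β : ℝ) (Λ : Box d) (J : Couplings d) (τ : Λ.sites → ℤˣ) : ℝ :=
  Real.exp (-β * hamiltonian Λ J (Λ.extend τ)) / partitionFunction β Λ J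

/-- The Gibbs measure `G_{Λ,β,J}`. -/
def gibbsMeasure {d : ℕ} (β : ℝ) (Λ : Box d) (J : Couplings d) : Measure (Config d) :=
  ∑ τ : Λ.sites → ℤˣ, ENNReal.ofReal (gibbsWeight β Λ J τ) • Measure.dirac (Λ.extend τ)

lemma partitionFunction_pos {d : ℕ} (β : ℝ) (Λ : Box d) (J : Couplings d) :
    0 < partitionFunction β Λ J :=
  Finset.sum_pos (fun _ _ => Real.exp_pos _) Finset.univ_nonempty

instance {d : ℕ} (β : ℝ) (Λ : Box d) (J : Couplings d) :
    IsProbabilityMeasure (gibbsMeasure β Λ J) where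
  measure_univ := by
    have h : ∀ τ ∈ (Finset.univ : Finset (Λ.sites → ℤˣ)), 0 ≤ gibbsWeight β Λ J τ :=
      fun τ _ => div_nonneg (Real.exp_pos _).le (partitionFunction_pos β Λ J).le
    simp only [gibbsMeasure, Measure.coe_finsetSum, Finset.sum_apply, Measure.smul_apply,
      measure_univ, smul_eq_mul, mul_one]
    rw [← ENNReal.ofReal_sum_of_nonneg h]
    simp only [gibbsWeight]
    rw [← Finset.sum_div]
    change ENNReal.ofReal (partitionFunction β Λ J / partitionFunction β Λ J) = 1
    rw [div_self (partitionFunction_pos β Λ J).ne', ENNReal.ofReal_one]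

/-- The Gibbs measure as a point of the space of probability measures on configurations. -/
def gibbs {d : ℕ} (β : ℝ) (Λ : Box d) (J : Couplings d) : ProbabilityMeasure (Config d) :=
  ⟨gibbsMeasure β Λ J, inferInstance⟩

lemma measurable_hamiltonian {d : ℕ} (Λ : Box d) (σ : Config d) :
    Measurable (fun J : Couplings d => hamiltonian Λ J σ) := by
  unfold hamiltonian
  fun_prop

lemma measurable_gibbs {d : ℕ} (β : ℝ) (Λ : Box d) :
    Measurable (gibbs (d := d) β Λ) := by
  refine Measurable.subtype_mk ?_
  refine Measure.measurable_of_measurable_coe _ fun s _ => ?_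
  simp only [gibbsMeasure, Measure.coe_finsetSum, Finset.sum_apply, Measure.smul_apply,
    smul_eq_mul]
  refine Finset.measurable_sum _ fun τ _ => ?_
  refine Measurable.mul_const ?_ _
  refine ENNReal.measurable_ofReal.comp ?_
  have h : ∀ τ : Λ.sites → ℤˣ, Measurable
      (fun J : Couplings d => Real.exp (-β * hamiltonian Λ J (Λ.extend τ))) := fun τ =>
    Real.measurable_exp.comp ((measurable_hamiltonian Λ _).const_mul _)
  exact (h τ).div (Finset.measurable_sum _ fun τ _ => h τ)

/-! ### Replicas and metastates -/

/-- `Γ ↦ ∏_{i ∈ ℕ} Γ`, the law of an infinite sequence of independent samples of `Γ`. -/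
def iidKernel (d : ℕ) : Kernel (ProbabilityMeasure (Config d)) (ℕ → Config d) where
  toFun Γ := Measure.infinitePi (fun _ : ℕ => (Γ : Measure (Config d)))
  measurable' := by
    refine Measurable.measure_of_isPiSystem_of_isProbabilityMeasure
      (generateFrom_squareCylinders (α := fun _ : ℕ => Config d)).symm
      (isPiSystem_squareCylinders (fun _ => MeasurableSpace.isPiSystem_measurableSet)
        (fun _ => by simp)) ?_
    rintro _ ⟨s, t, ht, rfl⟩
    have ht' : ∀ i ∈ s, MeasurableSet (t i) := fun i _ => ht i (Set.mem_univ i)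
    simp_rw [Measure.infinitePi_pi _ ht']
    exact Finset.measurable_prod _ fun i hi =>
      (Measure.measurable_coe (ht' i hi)).comp measurable_subtype_coe

instance (d : ℕ) : IsMarkovKernel (iidKernel d) where
  isProbabilityMeasure Γ := by
    change IsProbabilityMeasure (Measure.infinitePi (fun _ : ℕ => (Γ : Measure (Config d))))
    infer_instance

/-- `J ↦ ∏_{i ∈ ℕ} G_{Λ,β,J}`, the law of an infinite sequence of replicas in finite volume. -/
def gibbsReplicas {d : ℕ} (β : ℝ) (Λ : Box d) : Kernel (Couplings d) (ℕ → Config d) :=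
  (iidKernel d).comap (gibbs β Λ) (measurable_gibbs β Λ)

/-- `J ↦ ∫ κ_J(dΓ) ∏_{i ∈ ℕ} Γ`, the law of an infinite sequence of replicas sampled from a
random state `Γ`, itself sampled from `κ_J`. -/
def replicas {d : ℕ} (κ : Kernel (Couplings d) (ProbabilityMeasure (Config d))) :
    Kernel (Couplings d) (ℕ → Config d) :=
  iidKernel d ∘ₖ κ

/-- The boxes `Λ_n` converge to `ℤ^d`: every site, hence every finite set of sites, is eventually
in `Λ_n`. -/
def ExhaustsLattice {d : ℕ} (Λ : ℕ → Box d) : Prop :=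
  ∀ x : Site d, ∀ᶠ n in atTop, x ∈ (Λ n).sites

/-- `κ` is a metastate of the Gibbs measures `(G_{Λ_n,β,J})_n`: along some subsequence,
`ν(dJ) ∏_i G_{Λ_{n_k},β,J}` converges to `ν(dJ) ∫ κ_J(dΓ) ∏_i Γ` in the sense of
finite-dimensional distributions, i.e. the laws of finitely many couplings together with finitely
many replicas in a finite window converge weakly. -/
def IsMetastate {d : ℕ} (ν₀ : Measure ℝ) [IsProbabilityMeasure ν₀] (β : ℝ) (Λ : ℕ → Box d)
    (κ : Kernel (Couplings d) (ProbabilityMeasure (Config d))) : Prop :=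
  ∃ φ : ℕ → ℕ, StrictMono φ ∧
    ∀ (E : Finset (Edge d)) (W : Finset (Site d)) (s : ℕ)
      (f : ((E → ℝ) × (Fin s → W → ℤˣ)) →ᵇ ℝ),
      Tendsto
        (fun k => ∫ ω, f (E.restrict ω.1, fun i => W.restrict (ω.2 i))
          ∂(couplingLaw d ν₀ ⊗ₘ gibbsReplicas β (Λ (φ k))))
        atTop
        (𝓝 (∫ ω, f (E.restrict ω.1, fun i => W.restrict (ω.2 i))
          ∂(couplingLaw d ν₀ ⊗ₘ replicas κ)))

/-! ### Edge overlaps -/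

/-- The set `W*` of nearest-neighbour edges with both endpoints in `W`. -/
def edgesIn {d : ℕ} (W : Finset (Site d)) : Finset (Edge d) :=
  {e ∈ W ×ˢ Finset.univ | e.1 + Pi.single e.2 1 ∈ W}

/-- The edge overlap `R^W` in the finite window `W`. -/
def windowOverlap {d : ℕ} (W : Finset (Site d)) (σ σ' : Config d) : ℝ :=
  (1 / ((edgesIn W).card : ℝ)) * ∑ e ∈ edgesIn W,
    spin σ e.1 * spin σ (e.1 + Pi.single e.2 1) *
      spin σ' e.1 * spin σ' (e.1 + Pi.single e.2 1)

/-- The cube `[-n, n]^d`. -/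
def cube (d n : ℕ) : Finset (Site d) := Finset.Icc (fun _ => -(n : ℤ)) (fun _ => (n : ℤ))

/-- The limit defining the edge overlap of `σ` and `σ'` exists. -/
def HasOverlap {d : ℕ} (σ σ' : Config d) : Prop :=
  ∃ r : ℝ, Tendsto (fun n => windowOverlap (cube d n) σ σ') atTop (𝓝 r)

/-- The edge overlap `R(σ, σ')`, the limit of `R^W(σ, σ')` as the cube `W = [-n, n]^d` grows to
`ℤ^d`. It is meaningful when `HasOverlap σ σ'`, and a fixed junk value otherwise. -/
def overlap {d : ℕ} (σ σ' : Config d) : ℝ :=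
  limUnder atTop (fun n => windowOverlap (cube d n) σ σ')

/-- The matrix of overlaps of a sequence of replicas. -/
def overlapMatrix {d : ℕ} (σ : ℕ → Config d) : ℕ → ℕ → ℝ :=
  fun i j => overlap (σ i) (σ j)

lemma measurable_spin {d : ℕ} (x : Site d) : Measurable (fun σ : Config d => spin σ x) :=
  (measurable_of_finite (fun u : ℤˣ => ((u : ℤ) : ℝ))).comp (measurable_pi_apply x)

lemma measurable_windowOverlap {d : ℕ} (W : Finset (Site d)) :
    Measurable (fun p : Config d × Config d => windowOverlap W p.1 p.2) := by
  have h1 : ∀ x, Measurable (fun p : Config d × Config d => spin p.1 x) :=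
    fun x => (measurable_spin x).comp measurable_fst
  have h2 : ∀ x, Measurable (fun p : Config d × Config d => spin p.2 x) :=
    fun x => (measurable_spin x).comp measurable_snd
  unfold windowOverlap
  exact (Finset.measurable_sum _ fun e _ =>
    (((h1 _).mul (h1 _)).mul (h2 _)).mul (h2 _)).const_mul _

lemma measurable_overlap {d : ℕ} :
    Measurable (fun p : Config d × Config d => overlap p.1 p.2) := by
  classical
  have hW := fun n => measurable_windowOverlap (cube d n)
  have hA : MeasurableSet {p : Config d × Config d | HasOverlap p.1 p.2} :=
    measurableSet_exists_tendsto hW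
  have hL : Measurable (fun p : Config d × Config d =>
      limsup (fun n => windowOverlap (cube d n) p.1 p.2) atTop) := Measurable.limsup hW
  have key : (fun p : Config d × Config d => overlap p.1 p.2) = fun p =>
      if HasOverlap p.1 p.2 then limsup (fun n => windowOverlap (cube d n) p.1 p.2) atTop
      else Classical.epsilon fun _ : ℝ => False := by
    funext p
    by_cases hp : HasOverlap p.1 p.2
    · rw [if_pos hp]
      obtain ⟨r, hr⟩ := hp
      rw [overlap, hr.limUnder_eq, hr.limsup_eq]
    · rw [if_neg hp, overlap, limUnder, lim]
      congr 1
      funext r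
      exact eq_false fun h => hp ⟨r, h⟩
  rw [key]
  exact Measurable.ite hA hL measurable_const

lemma measurable_overlapMatrix {d : ℕ} : Measurable (overlapMatrix (d := d)) := by
  refine measurable_pi_iff.2 fun i => measurable_pi_iff.2 fun j => ?_
  have h : Measurable (fun σ : ℕ → Config d => (σ i, σ j)) :=
    Measurable.prodMk (measurable_pi_apply (X := fun _ : ℕ => Config d) i)
      (measurable_pi_apply (X := fun _ : ℕ => Config d) j)
  have e : (fun σ : ℕ → Config d => overlapMatrix σ i j) =
      (fun p : Config d × Config d => overlap p.1 p.2) ∘ (fun σ => (σ i, σ j)) := rfl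
  rw [e]
  exact measurable_overlap.comp h

/-! ### Random overlap structures -/

/-- `P` is the law of a random overlap structure: a random symmetric positive semidefinite
`ℕ × ℕ` matrix with ones on the diagonal, whose law is invariant under the simultaneous
permutation of finitely many rows and columns. -/
structure IsROSt (P : Measure (ℕ → ℕ → ℝ)) : Prop where
  isProbabilityMeasure : IsProbabilityMeasure P
  diag : ∀ᵐ q ∂P, ∀ i, q i i = 1
  posSemidef : ∀ᵐ q ∂P, (Matrix.of q).PosSemidef
  exchangeable : ∀ π : Equiv.Perm ℕ, {i | π i ≠ i}.Finite →
    P.map (fun q i j => q (π i) (π j)) = P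

/-- `J ↦` the law of `Q_J`, the matrix of `R`-overlaps of replicas sampled from `Γ`, where `Γ` is
sampled from `κ_J`. -/
def rost {d : ℕ} (κ : Kernel (Couplings d) (ProbabilityMeasure (Config d))) :
    Kernel (Couplings d) (ℕ → ℕ → ℝ) :=
  (replicas κ).map overlapMatrix

/-- The law of the averaged matrix `Q`: the average over `ν(dJ)` of the law of `Q_J`. -/
def averagedRost {d : ℕ} (ν₀ : Measure ℝ) [IsProbabilityMeasure ν₀]
    (κ : Kernel (Couplings d) (ProbabilityMeasure (Config d))) : Measure (ℕ → ℕ → ℝ) :=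
  (couplingLaw d ν₀).bind (rost κ)

end EdwardsAnderson

end

/-! On a torus, a joint rotation of couplings and replicas preserves the law `ν(dJ) ∏ G_{Λ,β,J}`. On
a fixed finite window, rotation by one step is a translation as soon as the box is large. Hence the
limit `M = ν(dJ) ∫ κ_J(dΓ) ∏ Γ` is invariant under joint translations of couplings and replicas
(`measurePreserving_translate`).

The window overlaps are averages of an edge observable along this `ℤ^d`-action, so they converge
`M`-almost surely by a pointwise ergodic theorem (`ae_exists_tendsto_boxAverage`). That theorem is
proved one direction at a time. The average over the earlier directions varies with `n`, so each new
direction calls for Maker's extension of Birkhoff's theorem.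

Translating the replicas alters the window overlaps only through boundary terms, so an event `U`
about the overlap matrix is translation invariant up to null sets. The measure `B ↦ M(B × U)` on
couplings is then translation invariant and absolutely continuous with respect to `ν`. Independent
couplings are ergodic, so this measure is a multiple of `ν` and its density, the conditional
probability of `U` given `J`, is almost surely constant (`exists_ae_replicas_eq_const`). Only the
invariance of the joint law enters, not a covariance property of `κ` itself.

The structural properties are soft: overlaps are limits of Gram matrices, and replicas are
exchangeable because they are i.i.d. given `Γ`. -/

namespace EdwardsAnderson

/-! ### The pointwise ergodic theorem for bounded functions -/

section Birkhoff

lemma isBoundedUnder_le_of_abs_le {u : ℕ → ℝ} {C : ℝ} (h : ∀ n, |u n| ≤ C) :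
    IsBoundedUnder (· ≤ ·) atTop u :=
  isBoundedUnder_of ⟨C, fun n => (abs_le.1 (h n)).2⟩

lemma isCoboundedUnder_le_of_abs_le {u : ℕ → ℝ} {C : ℝ} (h : ∀ n, |u n| ≤ C) :
    IsCoboundedUnder (· ≤ ·) atTop u :=
  IsBoundedUnder.isCoboundedUnder_le (isBoundedUnder_of ⟨-C, fun n => (abs_le.1 (h n)).1⟩)

lemma abs_limsup_le {u : ℕ → ℝ} {C : ℝ} (h : ∀ n, |u n| ≤ C) : |limsup u atTop| ≤ C := by
  refine abs_le.2 ⟨?_, ?_⟩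
  · exact le_limsup_of_frequently_le
      (Frequently.of_forall fun n => (abs_le.1 (h n)).1) (isBoundedUnder_le_of_abs_le h)
  · exact limsup_le_of_le (isCoboundedUnder_le_of_abs_le h)
      (Eventually.of_forall fun n => (abs_le.1 (h n)).2)

lemma limsup_le_of_tendsto_sub {u v : ℕ → ℝ} {C : ℝ} (hu : ∀ n, |u n| ≤ C) (hv : ∀ n, |v n| ≤ C)
    (h : Tendsto (fun n => u n - v n) atTop (𝓝 0)) : limsup u atTop ≤ limsup v atTop := by
  refine le_of_forall_pos_le_add fun ε hε => ?_
  refine limsup_le_of_le (isCoboundedUnder_le_of_abs_le hu) ?_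
  have h1 : limsup v atTop < limsup v atTop + ε / 2 := by linarith
  filter_upwards [eventually_lt_of_limsup_lt h1 (isBoundedUnder_le_of_abs_le hv),
    h.eventually (gt_mem_nhds (half_pos hε))] with n h2 h3
  linarith

lemma abs_birkhoffAverage_le {Ω : Type*} (T : Ω → Ω) {f : Ω → ℝ} {C : ℝ}
    (hf : ∀ x, |f x| ≤ C) (n : ℕ) (x : Ω) : |birkhoffAverage ℝ T f n x| ≤ C := by
  have hC : 0 ≤ C := (abs_nonneg _).trans (hf x)
  rcases Nat.eq_zero_or_pos n with rfl | hn
  · simpa using hC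
  have hn' : (0 : ℝ) < n := by exact_mod_cast hn
  rw [birkhoffAverage, smul_eq_mul, abs_mul, abs_inv, Nat.abs_cast, inv_mul_le_iff₀ hn']
  refine (Finset.abs_sum_le_sum_abs _ _).trans ?_
  refine (Finset.sum_le_sum fun k _ => hf _).trans ?_
  simp

variable {Ω : Type*} {T : Ω → Ω}

/-- The maximum of `0` and the first `N` Birkhoff sums of `f`. -/
noncomputable def birkhoffMax (T : Ω → Ω) (f : Ω → ℝ) : ℕ → Ω → ℝ
  | 0 => fun _ => 0
  | N + 1 => fun x => max 0 (f x + birkhoffMax T f N (T x))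

lemma birkhoffMax_nonneg (f : Ω → ℝ) (N : ℕ) (x : Ω) : 0 ≤ birkhoffMax T f N x := by
  cases N with
  | zero => exact le_rfl
  | succ N => exact le_max_left _ _

lemma birkhoffMax_le_succ (f : Ω → ℝ) (N : ℕ) (x : Ω) :
    birkhoffMax T f N x ≤ birkhoffMax T f (N + 1) x := by
  induction N generalizing x with
  | zero => exact birkhoffMax_nonneg f _ x
  | succ N ih =>
    change max 0 (f x + birkhoffMax T f N (T x)) ≤ max 0 (f x + birkhoffMax T f (N + 1) (T x))
    exact max_le_max le_rfl (add_le_add le_rfl (ih (T x)))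

lemma birkhoffSum_le_birkhoffMax (f : Ω → ℝ) (N : ℕ) (x : Ω) :
    birkhoffSum T f N x ≤ birkhoffMax T f N x := by
  induction N generalizing x with
  | zero => simp [birkhoffMax]
  | succ N ih =>
    rw [birkhoffSum_succ']
    exact (add_le_add le_rfl (ih (T x))).trans (le_max_right _ _)

lemma birkhoffMax_le {f : Ω → ℝ} {C : ℝ} (hC : 0 ≤ C) (hf : ∀ x, |f x| ≤ C) (N : ℕ) (x : Ω) :
    birkhoffMax T f N x ≤ N * C := by
  induction N generalizing x with
  | zero => simp [birkhoffMax]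
  | succ N ih =>
    have h1 := (abs_le.1 (hf x)).2
    have h2 := ih (T x)
    refine max_le (by positivity) ?_
    push_cast
    linarith

variable [MeasurableSpace Ω] {μ : Measure Ω}

lemma measurable_birkhoffSum (hT : Measurable T) {f : Ω → ℝ} (hf : Measurable f) (n : ℕ) :
    Measurable (birkhoffSum T f n) := by
  unfold birkhoffSum
  exact Finset.measurable_sum _ fun k _ => hf.comp (hT.iterate k)

lemma measurable_birkhoffAverage (hT : Measurable T) {f : Ω → ℝ} (hf : Measurable f) (n : ℕ) :
    Measurable (birkhoffAverage ℝ T f n) := by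
  exact (measurable_birkhoffSum hT hf n).const_mul (n : ℝ)⁻¹

lemma integrable_of_abs_le [IsFiniteMeasure μ] {f : Ω → ℝ} (hf : Measurable f) {C : ℝ}
    (h : ∀ x, |f x| ≤ C) : Integrable f μ :=
  Integrable.of_bound hf.aestronglyMeasurable C (Eventually.of_forall fun x => h x)

lemma measurable_birkhoffMax (hT : Measurable T) {f : Ω → ℝ} (hf : Measurable f) (N : ℕ) :
    Measurable (birkhoffMax T f N) := by
  induction N with
  | zero => exact measurable_const
  | succ N ih => exact measurable_const.max (hf.add (ih.comp hT))

/-- The maximal ergodic inequality. -/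
lemma setIntegral_birkhoffMax_pos_nonneg [IsFiniteMeasure μ] (hT : MeasurePreserving T μ μ)
    {f : Ω → ℝ} (hf : Measurable f) {C : ℝ} (hC : ∀ x, |f x| ≤ C) (N : ℕ) :
    0 ≤ ∫ x, {x | 0 < birkhoffMax T f N x}.indicator f x ∂μ := by
  rcases isEmpty_or_nonempty Ω with h | ⟨⟨x₀⟩⟩
  · simp [Measure.eq_zero_of_isEmpty]
  have hC0 : 0 ≤ C := (abs_nonneg _).trans (hC x₀)
  have hM := measurable_birkhoffMax hT.measurable hf N
  have hMi : Integrable (birkhoffMax T f N) μ := integrable_of_abs_le (C := N * C) hM fun x => by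
    rw [abs_of_nonneg (birkhoffMax_nonneg f N x)]
    exact birkhoffMax_le hC0 hC N x
  have hMi' : Integrable (fun x => birkhoffMax T f N (T x)) μ := hT.integrable_comp_of_integrable hMi
  -- With `M` the maximum, `M - M ∘ T` integrates to zero, so it is enough that it lies below `f`
  -- where `M > 0` and below `0` elsewhere.
  have h0 : ∫ x, (birkhoffMax T f N x - birkhoffMax T f N (T x)) ∂μ = 0 := by
    rw [integral_sub hMi hMi', sub_eq_zero]
    conv_lhs => rw [← hT.map_eq]
    exact integral_map hT.measurable.aemeasurable hM.aestronglyMeasurable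
  refine h0.symm.le.trans (integral_mono (hMi.sub hMi')
    ((integrable_of_abs_le hf hC).indicator (measurableSet_lt measurable_const hM)) fun x => ?_)
  change birkhoffMax T f N x - birkhoffMax T f N (T x) ≤ _
  by_cases hx : 0 < birkhoffMax T f N x
  · rw [Set.indicator_of_mem (show x ∈ {x | 0 < birkhoffMax T f N x} from hx)]
    cases N with
    | zero => exact absurd hx (lt_irrefl _)
    | succ N =>
      have h1 : birkhoffMax T f (N + 1) x = f x + birkhoffMax T f N (T x) := by
        rcases max_choice 0 (f x + birkhoffMax T f N (T x)) with h | h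
        · exact absurd (show birkhoffMax T f (N + 1) x = 0 from h) hx.ne'
        · exact h
      have h2 := birkhoffMax_le_succ (T := T) f N (T x)
      change birkhoffMax T f (N + 1) x - birkhoffMax T f (N + 1) (T x) ≤ f x
      linarith
  · rw [Set.indicator_of_notMem (show x ∉ {x | 0 < birkhoffMax T f N x} from hx)]
    have h1 := birkhoffMax_nonneg (T := T) f N (T x)
    change birkhoffMax T f N x - birkhoffMax T f N (T x) ≤ 0
    linarith [not_lt.1 hx]

/-- The sets in the maximal inequality increase to the whole space as `N → ∞`, so the indicator
disappears in the limit. -/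
lemma integral_nonneg_of_exists_birkhoffSum_pos [IsFiniteMeasure μ] (hT : MeasurePreserving T μ μ)
    {f : Ω → ℝ} (hf : Measurable f) {C : ℝ} (hC : ∀ x, |f x| ≤ C)
    (h : ∀ x, ∃ n, 0 < birkhoffSum T f n x) : 0 ≤ ∫ x, f x ∂μ := by
  have hlim : Tendsto (fun N => ∫ x, {x | 0 < birkhoffMax T f N x}.indicator f x ∂μ) atTop
      (𝓝 (∫ x, f x ∂μ)) := by
    refine tendsto_integral_of_dominated_convergence (fun _ => C) (fun N => ?_)
      (integrable_const C) (fun N => ?_) ?_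
    · exact (hf.indicator (measurableSet_lt measurable_const
        (measurable_birkhoffMax hT.measurable hf N))).aestronglyMeasurable
    · refine Eventually.of_forall fun x => ?_
      exact (norm_indicator_le_norm_self _ _).trans (hC x)
    · refine Eventually.of_forall fun x => ?_
      obtain ⟨n, hn⟩ := h x
      refine tendsto_const_nhds.congr' ?_
      filter_upwards [eventually_ge_atTop n] with N hN
      refine (Set.indicator_of_mem ?_ _).symm
      have hmono : Monotone fun N => birkhoffMax T f N x :=
        monotone_nat_of_le_succ fun N => birkhoffMax_le_succ f N x
      exact hn.trans_le ((birkhoffSum_le_birkhoffMax f n x).trans (hmono hN))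
  exact ge_of_tendsto' hlim fun N => setIntegral_birkhoffMax_pos_nonneg hT hf hC N

/-- The limsup `F` is `T`-invariant, so the Birkhoff sums of `f - F + ε` are `S_n f - n (F - ε)`. At
every point one of them is positive by the definition of limsup, and the maximal inequality gives `∫
F ≤ ∫ f + ε`. -/
lemma integral_limsup_birkhoffAverage_le [IsProbabilityMeasure μ] (hT : MeasurePreserving T μ μ)
    {f : Ω → ℝ} (hf : Measurable f) {C : ℝ} (hC : ∀ x, |f x| ≤ C) :
    ∫ x, limsup (fun n => birkhoffAverage ℝ T f n x) atTop ∂μ ≤ ∫ x, f x ∂μ := by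
  set F : Ω → ℝ := fun x => limsup (fun n => birkhoffAverage ℝ T f n x) atTop with hF
  have hFm : Measurable F := Measurable.limsup fun n => measurable_birkhoffAverage hT.measurable hf n
  have hb : ∀ x n, |birkhoffAverage ℝ T f n x| ≤ C := fun x n => abs_birkhoffAverage_le T hC n x
  have hFC : ∀ x, |F x| ≤ C := fun x => abs_limsup_le (hb x)
  have hbd : Bornology.IsBounded (Set.range f) :=
    isBounded_iff_forall_norm_le.2 ⟨C, by rintro _ ⟨x, rfl⟩; exact hC x⟩
  have hFT : ∀ x, F (T x) = F x := fun x => by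
    have h0 := tendsto_birkhoffAverage_apply_sub_birkhoffAverage' ℝ hbd T x
    refine le_antisymm (limsup_le_of_tendsto_sub (hb _) (hb _) h0) ?_
    refine limsup_le_of_tendsto_sub (hb _) (hb _) ?_
    simpa using h0.neg
  have hFk : ∀ k x, F (T^[k] x) = F x := fun k x => by
    induction k generalizing x with
    | zero => rfl
    | succ k ih => rw [Function.iterate_succ_apply, ih, hFT]
  refine le_of_forall_pos_le_add fun ε hε => ?_
  have key : 0 ≤ ∫ x, (f x - F x + ε) ∂μ := by
    refine integral_nonneg_of_exists_birkhoffSum_pos (C := C + C + ε) hT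
      ((hf.sub hFm).add_const ε) (fun x => ?_) fun x => ?_
    · have h1 := abs_le.1 (hC x)
      have h2 := abs_le.1 (hFC x)
      exact abs_le.2 ⟨by linarith, by linarith⟩
    · have hlt : F x - ε < limsup (fun n => birkhoffAverage ℝ T f n x) atTop := by
        change F x - ε < F x
        linarith
      have hfr := frequently_lt_of_lt_limsup (isCoboundedUnder_le_of_abs_le (hb x)) hlt
      obtain ⟨n, hn, hn1⟩ := (hfr.and_eventually (eventually_ge_atTop 1)).exists
      refine ⟨n, ?_⟩
      have hn' : (0 : ℝ) < n := by exact_mod_cast hn1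
      have hs : birkhoffSum T (fun x => f x - F x + ε) n x
          = birkhoffSum T f n x - n * (F x - ε) := by
        simp only [birkhoffSum, hFk, Finset.sum_add_distrib, Finset.sum_sub_distrib,
          Finset.sum_const, Finset.card_range, nsmul_eq_mul]
        ring
      rw [birkhoffAverage, smul_eq_mul, ← div_eq_inv_mul, lt_div_iff₀ hn'] at hn
      rw [hs]
      linarith
  have hfi : Integrable f μ := integrable_of_abs_le hf hC
  have hFi : Integrable F μ := integrable_of_abs_le hFm hFC
  rw [integral_add (show Integrable (fun x => f x - F x) μ from hfi.sub hFi) (integrable_const ε),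
    integral_sub hfi hFi] at key
  simp only [integral_const, probReal_univ, smul_eq_mul, one_mul] at key
  linarith

/-- Birkhoff's pointwise ergodic theorem for bounded functions. -/
theorem ae_exists_tendsto_birkhoffAverage [IsProbabilityMeasure μ] (hT : MeasurePreserving T μ μ)
    {f : Ω → ℝ} (hf : Measurable f) {C : ℝ} (hC : ∀ x, |f x| ≤ C) :
    ∀ᵐ x ∂μ, ∃ r, Tendsto (fun n => birkhoffAverage ℝ T f n x) atTop (𝓝 r) := by
  have hC' : ∀ x, |(-f) x| ≤ C := fun x => by simpa using hC x
  set F : Ω → ℝ := fun x => limsup (fun n => birkhoffAverage ℝ T f n x) atTop with hF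
  set G : Ω → ℝ := fun x => limsup (fun n => birkhoffAverage ℝ T (-f) n x) atTop with hG
  have hFm : Measurable F := Measurable.limsup fun n => measurable_birkhoffAverage hT.measurable hf n
  have hGm : Measurable G :=
    Measurable.limsup fun n => measurable_birkhoffAverage hT.measurable hf.neg n
  have hb : ∀ x n, |birkhoffAverage ℝ T f n x| ≤ C := fun x n => abs_birkhoffAverage_le T hC n x
  have hb' : ∀ x n, |birkhoffAverage ℝ T (-f) n x| ≤ C :=
    fun x n => abs_birkhoffAverage_le T hC' n x
  have hFi : Integrable F μ := integrable_of_abs_le hFm fun x => abs_limsup_le (hb x)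
  have hGi : Integrable G μ := integrable_of_abs_le hGm fun x => abs_limsup_le (hb' x)
  have hneg : ∀ x n, birkhoffAverage ℝ T (-f) n x = - birkhoffAverage ℝ T f n x := fun x n => by
    simp [birkhoffAverage, birkhoffSum]
  have hup : ∀ x ε, 0 < ε → ∀ᶠ n in atTop, birkhoffAverage ℝ T f n x < F x + ε :=
    fun x ε hε => eventually_lt_of_limsup_lt
      (show limsup (fun n => birkhoffAverage ℝ T f n x) atTop < F x + ε from
        lt_add_of_pos_right _ hε) (isBoundedUnder_le_of_abs_le (hb x))
  have hlo : ∀ x ε, 0 < ε → ∀ᶠ n in atTop, - birkhoffAverage ℝ T f n x < G x + ε := by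
    intro x ε hε
    have := eventually_lt_of_limsup_lt
      (show limsup (fun n => birkhoffAverage ℝ T (-f) n x) atTop < G x + ε from
        lt_add_of_pos_right _ hε) (isBoundedUnder_le_of_abs_le (hb' x))
    simpa only [hneg] using this
  -- Here `G` is minus the liminf, so `F + G` is the oscillation of the averages. Its integral is at
  -- most `∫ f - ∫ f = 0`, which forces it to vanish almost everywhere.
  have hnn : ∀ x, 0 ≤ F x + G x := fun x => by
    refine le_of_forall_pos_le_add fun ε hε => ?_
    obtain ⟨n, h1, h2⟩ := ((hup x _ (half_pos hε)).and (hlo x _ (half_pos hε))).exists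
    linarith
  have hint : ∫ x, (F x + G x) ∂μ = 0 := by
    refine le_antisymm ?_ (integral_nonneg hnn)
    rw [integral_add hFi hGi]
    have h1 := integral_limsup_birkhoffAverage_le hT hf hC
    have h2 := integral_limsup_birkhoffAverage_le hT hf.neg hC'
    have h3 : ∫ x, (-f) x ∂μ = - ∫ x, f x ∂μ := integral_neg f
    linarith
  have hae := (integral_eq_zero_iff_of_nonneg hnn (hFi.add hGi)).1 hint
  filter_upwards [hae] with x hx
  have hx' : G x = - F x := by
    have : F x + G x = 0 := hx
    linarith
  refine ⟨F x, tendsto_order.2 ⟨fun a ha => ?_, fun a ha => ?_⟩⟩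
  · filter_upwards [hlo x (F x - a) (by linarith)] with n hn
    linarith
  · filter_upwards [hup x (a - F x) (by linarith)] with n hn
    linarith

/-- Maker's ergodic theorem: in the ergodic averages, the function may be replaced by an almost
surely convergent, uniformly bounded sequence. -/
theorem ae_exists_tendsto_birkhoffAverage_of_tendsto [IsProbabilityMeasure μ]
    (hT : MeasurePreserving T μ μ) {g : ℕ → Ω → ℝ} (hg : ∀ n, Measurable (g n)) {C : ℝ}
    (hC : ∀ n x, |g n x| ≤ C) (hlim : ∀ᵐ x ∂μ, ∃ r, Tendsto (fun n => g n x) atTop (𝓝 r)) :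
    ∀ᵐ x ∂μ, ∃ r, Tendsto (fun n => birkhoffAverage ℝ T (g n) n x) atTop (𝓝 r) := by
  set G : Ω → ℝ := fun x => limsup (fun n => g n x) atTop with hG
  have hGm : Measurable G := Measurable.limsup hg
  have hGC : ∀ x, |G x| ≤ C := fun x => abs_limsup_le fun n => hC n x
  -- For a fixed `N`, `D N` dominates `|g n - G|` for all `n ≥ N`. The limsup of the averaged errors
  -- therefore has integral at most `∫ D N`, and this tends to zero.
  set D : ℕ → Ω → ℝ := fun N x => ⨆ m, |g (N + m) x - G x| with hD
  have hd : ∀ n x, |g n x - G x| ≤ C + C := fun n x =>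
    (abs_sub _ _).trans (add_le_add (hC n x) (hGC x))
  have hbdd : ∀ N x, BddAbove (Set.range fun m => |g (N + m) x - G x|) := fun N x =>
    ⟨C + C, by rintro _ ⟨m, rfl⟩; exact hd _ x⟩
  have hDm : ∀ N, Measurable (D N) := fun N =>
    Measurable.iSup fun m => ((hg _).sub hGm).abs
  have hD0 : ∀ N x, 0 ≤ D N x := fun N x => Real.iSup_nonneg fun m => abs_nonneg _
  have hDC : ∀ N x, |D N x| ≤ C + C := fun N x => by
    rw [abs_of_nonneg (hD0 N x)]
    exact ciSup_le fun m => hd _ x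
  have hDlim : ∀ᵐ x ∂μ, Tendsto (fun N => D N x) atTop (𝓝 0) := by
    filter_upwards [hlim] with x ⟨r, hr⟩
    have hGr : G x = r := hr.limsup_eq
    rw [Metric.tendsto_atTop] at hr ⊢
    intro ε hε
    obtain ⟨N₀, hN₀⟩ := hr (ε / 2) (half_pos hε)
    refine ⟨N₀, fun N hN => ?_⟩
    rw [Real.dist_eq, sub_zero, abs_of_nonneg (hD0 N x)]
    refine lt_of_le_of_lt (ciSup_le fun m => ?_) (half_lt_self hε)
    rw [hGr]
    exact (hN₀ (N + m) (by omega)).le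
  have hDint : Tendsto (fun N => ∫ x, D N x ∂μ) atTop (𝓝 0) := by
    have := tendsto_integral_of_dominated_convergence (μ := μ) (F := D) (f := fun _ => (0 : ℝ))
      (fun _ => C + C) (fun N => (hDm N).aestronglyMeasurable) (integrable_const _)
      (fun N => Eventually.of_forall fun x => hDC N x) hDlim
    simpa using this
  set a : ℕ → Ω → ℝ := fun n x => birkhoffAverage ℝ T (fun x => |g n x - G x|) n x with ha
  have ham : ∀ n, Measurable (a n) := fun n =>
    measurable_birkhoffAverage hT.measurable ((hg n).sub hGm).abs n
  have haC : ∀ n x, |a n x| ≤ C + C := fun n x =>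
    abs_birkhoffAverage_le T (fun x => by rw [abs_abs]; exact hd n x) n x
  have hmono : ∀ (f₁ f₂ : Ω → ℝ) (n : ℕ) (x : Ω), (∀ x, f₁ x ≤ f₂ x) →
      birkhoffAverage ℝ T f₁ n x ≤ birkhoffAverage ℝ T f₂ n x := fun f₁ f₂ n x h => by
    rw [birkhoffAverage, birkhoffAverage, smul_eq_mul, smul_eq_mul]
    exact mul_le_mul_of_nonneg_left (Finset.sum_le_sum fun k _ => h _) (by positivity)
  have ha0 : ∀ n x, 0 ≤ a n x := fun n x => by
    have h := hmono (fun _ => 0) (fun x => |g n x - G x|) n x fun x => abs_nonneg _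
    have h0 : birkhoffAverage ℝ T (fun _ => (0 : ℝ)) n x = 0 := by
      simp [birkhoffAverage, birkhoffSum]
    rwa [h0] at h
  set H : Ω → ℝ := fun x => limsup (fun n => a n x) atTop with hH
  have hHm : Measurable H := Measurable.limsup ham
  have hHC : ∀ x, |H x| ≤ C + C := fun x => abs_limsup_le fun n => haC n x
  have hH0 : ∀ x, 0 ≤ H x := fun x =>
    le_limsup_of_frequently_le (Frequently.of_forall fun n => ha0 n x)
      (isBoundedUnder_le_of_abs_le fun n => haC n x)
  have hHi : Integrable H μ := integrable_of_abs_le hHm hHC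
  have hHle : ∀ N, ∫ x, H x ∂μ ≤ ∫ x, D N x ∂μ := fun N => by
    refine le_trans ?_ (integral_limsup_birkhoffAverage_le hT (hDm N) (hDC N))
    have hb : ∀ x n, |birkhoffAverage ℝ T (D N) n x| ≤ C + C :=
      fun x n => abs_birkhoffAverage_le T (hDC N) n x
    refine integral_mono hHi (integrable_of_abs_le (C := C + C) (Measurable.limsup fun n =>
      measurable_birkhoffAverage hT.measurable (hDm N) n) fun x => abs_limsup_le (hb x))
      fun x => ?_
    refine limsup_le_limsup ?_ (isCoboundedUnder_le_of_abs_le fun n => haC n x)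
      (isBoundedUnder_le_of_abs_le (hb x))
    filter_upwards [eventually_ge_atTop N] with n hn
    refine hmono _ _ n x fun y => ?_
    have := le_ciSup (hbdd N y) (n - N)
    simpa [Nat.add_sub_cancel' hn] using this
  have hHint : ∫ x, H x ∂μ = 0 :=
    le_antisymm (ge_of_tendsto' hDint hHle) (integral_nonneg hH0)
  filter_upwards [(integral_eq_zero_iff_of_nonneg hH0 hHi).1 hHint,
    ae_exists_tendsto_birkhoffAverage hT hGm hGC] with x hx ⟨r, hr⟩
  refine ⟨r, ?_⟩
  have ha_lim : Tendsto (fun n => a n x) atTop (𝓝 0) := by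
    refine tendsto_order.2 ⟨fun b hb => Eventually.of_forall fun n => hb.trans_le (ha0 n x),
      fun b hb => ?_⟩
    refine eventually_lt_of_limsup_lt ?_ (isBoundedUnder_le_of_abs_le fun n => haC n x)
    change H x < b
    rw [show H x = 0 from hx]
    exact hb
  have hdiff : Tendsto (fun n => birkhoffAverage ℝ T (g n) n x - birkhoffAverage ℝ T G n x)
      atTop (𝓝 0) := by
    refine squeeze_zero_norm (fun n => ?_) ha_lim
    rw [Real.norm_eq_abs, birkhoffAverage, birkhoffAverage, ← smul_sub, smul_eq_mul, abs_mul,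
      birkhoffSum, birkhoffSum, ← Finset.sum_sub_distrib, abs_inv, Nat.abs_cast]
    exact mul_le_mul_of_nonneg_left (Finset.abs_sum_le_sum_abs _ _) (by positivity)
  simpa using hdiff.add hr

end Birkhoff

/-! ### The ergodic theorem for actions of `ℤ^d` -/

section BoxAverage

/-- The interval `[-n, n - c]`; we use it for `c = 0` and `c = 1`. -/
noncomputable def interval (c : ℤ) (n : ℕ) : Finset ℤ := Finset.Icc (-(n : ℤ)) (n - c)

/-- The interval `[-n, n - 1]` splits into a forward and a backward orbit of equal length `n`, so
two-sided averages reduce to one-sided ones. -/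
lemma sum_interval_one (G : ℤ → ℝ) (n : ℕ) :
    ∑ k ∈ interval 1 n, G k =
      ∑ k ∈ Finset.range n, G k + ∑ k ∈ Finset.range n, G (-1 - k) := by
  induction n with
  | zero => simp [interval]
  | succ n ih =>
    have h : interval 1 (n + 1) = insert (n : ℤ) (insert (-1 - (n : ℤ)) (interval 1 n)) := by
      ext k
      simp only [interval, Finset.mem_Icc, Finset.mem_insert]
      push_cast
      omega
    rw [h, Finset.sum_insert, Finset.sum_insert, ih, Finset.sum_range_succ, Finset.sum_range_succ]
    · ring
    · simp only [interval, Finset.mem_Icc]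
      omega
    · simp only [interval, Finset.mem_Icc, Finset.mem_insert]
      omega

lemma sum_interval_zero (G : ℤ → ℝ) (n : ℕ) :
    ∑ k ∈ interval 0 n, G k = ∑ k ∈ interval 1 n, G k + G n := by
  have h : interval 0 n = insert (n : ℤ) (interval 1 n) := by
    ext k
    simp only [interval, Finset.mem_Icc, Finset.mem_insert]
    omega
  rw [h, Finset.sum_insert, add_comm]
  simp only [interval, Finset.mem_Icc]
  omega

lemma card_interval_one (n : ℕ) : ((interval 1 n).card : ℝ) = 2 * n := by
  have := sum_interval_one (fun _ => (1 : ℝ)) n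
  simp only [Finset.sum_const, nsmul_eq_mul, mul_one, Finset.card_range] at this
  rw [this]
  ring

lemma card_interval_zero (n : ℕ) : ((interval 0 n).card : ℝ) = 2 * n + 1 := by
  have := sum_interval_zero (fun _ => (1 : ℝ)) n
  simp only [Finset.sum_const, nsmul_eq_mul, mul_one] at this
  rw [this, card_interval_one]

lemma tendsto_inv_card_interval {c : ℤ} (hc : c = 0 ∨ c = 1) :
    Tendsto (fun n => ((interval c n).card : ℝ)⁻¹) atTop (𝓝 0) := by
  have h1 : Tendsto (fun n : ℕ => (2 * n : ℝ)) atTop atTop :=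
    tendsto_natCast_atTop_atTop.const_mul_atTop two_pos
  rcases hc with rfl | rfl
  · simp only [card_interval_zero]
    exact (tendsto_atTop_add_const_right _ 1 h1).inv_tendsto_atTop
  · simp only [card_interval_one]
    exact h1.inv_tendsto_atTop

lemma abs_sum_div_card_le {ι : Type*} (s : Finset ι) {F : ι → ℝ} {C : ℝ} (hC : 0 ≤ C)
    (hF : ∀ x, |F x| ≤ C) : |(s.card : ℝ)⁻¹ * ∑ x ∈ s, F x| ≤ C := by
  rcases s.eq_empty_or_nonempty with rfl | hs
  · simpa using hC
  have hs' : (0 : ℝ) < s.card := by exact_mod_cast hs.card_pos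
  rw [abs_mul, abs_inv, Nat.abs_cast, inv_mul_le_iff₀ hs']
  refine (Finset.abs_sum_le_sum_abs _ _).trans ((Finset.sum_le_sum fun k _ => hF _).trans ?_)
  simp

/-- Shifting an interval by one step changes the sum only by two boundary values; this makes box
averages asymptotically translation invariant. -/
lemma telescope_interval (G : ℤ → ℝ) (c : ℤ) (hc : c = 0 ∨ c = 1) (n : ℕ) :
    ∑ k ∈ interval c n, G (k + 1) - ∑ k ∈ interval c n, G k = G (n - c + 1) - G (-n) := by
  have h1 : ∑ k ∈ interval 1 n, G (k + 1) - ∑ k ∈ interval 1 n, G k = G n - G (-n) := by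
    rw [sum_interval_one, sum_interval_one]
    have a := Finset.sum_range_sub (fun k : ℕ => G k) n
    have b := Finset.sum_range_sub (fun k : ℕ => G (-k)) n
    simp only [Finset.sum_sub_distrib, Nat.cast_add, Nat.cast_one, Nat.cast_zero, neg_zero] at a b
    have e1 : ∀ k : ℕ, G (-1 - k + 1) = G (-k) := fun k => by congr 1; ring
    have e2 : ∀ k : ℕ, G (-1 - k) = G (-(k + 1)) := fun k => by congr 1; ring
    simp only [e1, e2]
    linarith
  rcases hc with rfl | rfl
  · rw [sum_interval_zero, sum_interval_zero, sub_zero]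
    linarith
  · rw [h1]
    congr 2
    ring

variable {Ω : Type*} [MeasurableSpace Ω] {μ : Measure Ω}

/-- Maker's theorem for two-sided averages over an action of `ℤ`. -/
theorem ae_exists_tendsto_intervalAverage [IsProbabilityMeasure μ] {θ : ℤ → Ω → Ω}
    (hθ : ∀ k, MeasurePreserving (θ k) μ μ) (h0 : θ 0 = id)
    (hadd : ∀ j k ω, θ (j + k) ω = θ j (θ k ω)) {g : ℕ → Ω → ℝ} (hg : ∀ n, Measurable (g n))
    {C : ℝ} (hC : ∀ n x, |g n x| ≤ C)
    (hlim : ∀ᵐ x ∂μ, ∃ r, Tendsto (fun n => g n x) atTop (𝓝 r)) {c : ℤ} (hc : c = 0 ∨ c = 1) :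
    ∀ᵐ x ∂μ, ∃ r, Tendsto (fun n => ((interval c n).card : ℝ)⁻¹ *
      ∑ k ∈ interval c n, g n (θ k x)) atTop (𝓝 r) := by
  have hpos : ∀ (k : ℕ) ω, (θ 1)^[k] ω = θ k ω := fun k => by
    induction k with
    | zero => intro ω; simp [h0]
    | succ k ih => intro ω; rw [Function.iterate_succ_apply', ih, ← hadd, Nat.cast_succ, add_comm]
  have hneg : ∀ (k : ℕ) ω, (θ (-1))^[k] ω = θ (-k) ω := fun k => by
    induction k with
    | zero => intro ω; simp [h0]
    | succ k ih =>
      intro ω; rw [Function.iterate_succ_apply', ih, ← hadd, Nat.cast_succ, neg_add_rev]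
  have hA := ae_exists_tendsto_birkhoffAverage_of_tendsto (hθ 1) hg hC hlim
  -- The backward orbit starts at `-1` rather than `0`, hence the composition with `θ (-1)`.
  have hB := ae_exists_tendsto_birkhoffAverage_of_tendsto (hθ (-1))
    (g := fun n => g n ∘ θ (-1)) (fun n => (hg n).comp (hθ (-1)).measurable)
    (fun n x => hC n _) ((hθ (-1)).quasiMeasurePreserving.ae hlim)
  filter_upwards [hA, hB] with x ⟨r, hr⟩ ⟨s, hs⟩
  have hone : Tendsto (fun n => ((interval 1 n).card : ℝ)⁻¹ *
      ∑ k ∈ interval 1 n, g n (θ k x)) atTop (𝓝 (1 / 2 * (r + s))) := by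
    refine ((hr.add hs).const_mul (1 / 2)).congr fun n => ?_
    rw [card_interval_one, sum_interval_one, birkhoffAverage, birkhoffAverage, birkhoffSum,
      birkhoffSum, smul_eq_mul, smul_eq_mul, mul_inv]
    simp only [hpos, hneg, Function.comp_apply, ← hadd]
    simp only [← sub_eq_add_neg]
    ring
  rcases hc with rfl | rfl
  · refine ⟨1 / 2 * (r + s), ?_⟩
    have hC0 : 0 ≤ C := (abs_nonneg _).trans (hC 0 x)
    have hinv := tendsto_inv_card_interval (c := 0) (Or.inl rfl)
    -- For `c = 0` the interval has one extra point, of weight `1 / (2n + 1)`.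
    have hl : Tendsto (fun n => ((interval 0 n).card : ℝ)⁻¹ * g n (θ n x)) atTop (𝓝 0) := by
      refine squeeze_zero_norm (fun n => ?_) (by simpa using hinv.mul_const C)
      rw [Real.norm_eq_abs, abs_mul, abs_inv, Nat.abs_cast]
      exact mul_le_mul_of_nonneg_left (hC _ _) (by positivity)
    have hm : Tendsto (fun n => (1 - ((interval 0 n).card : ℝ)⁻¹) *
        (((interval 1 n).card : ℝ)⁻¹ * ∑ k ∈ interval 1 n, g n (θ k x))) atTop
        (𝓝 (1 / 2 * (r + s))) := by
      simpa using (hinv.const_sub 1).mul hone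
    have := hm.add hl
    rw [add_zero] at this
    refine this.congr' ?_
    filter_upwards [eventually_ge_atTop 1] with n hn
    have hn' : (0 : ℝ) < n := by exact_mod_cast hn
    rw [sum_interval_zero, card_interval_zero, card_interval_one]
    field_simp
    ring
  · exact ⟨_, hone⟩

variable {d : ℕ}

/-- The box with sides `[-n, n - c i]` in the directions `i ∈ s`, and sides `{0}` otherwise. -/
noncomputable def box (c : Fin d → ℤ) (s : Finset (Fin d)) (n : ℕ) : Finset (Site d) :=
  Fintype.piFinset fun i => if i ∈ s then interval (c i) n else {0}

lemma card_box (c : Fin d → ℤ) (s : Finset (Fin d)) (n : ℕ) :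
    (box c s n).card = ∏ i ∈ s, (interval (c i) n).card := by
  rw [box, Fintype.card_piFinset, ← Finset.prod_subset (Finset.subset_univ s)]
  · exact Finset.prod_congr rfl fun i hi => by rw [if_pos hi]
  · intro i _ hi
    rw [if_neg hi, Finset.card_singleton]

/-- Freezing the directions outside `s` at `0` lets a new direction be added to the box as a sum of
shifts. -/
lemma sum_box_insert (c : Fin d → ℤ) {s : Finset (Fin d)} {a : Fin d} (ha : a ∉ s) (n : ℕ)
    (F : Site d → ℝ) : ∑ x ∈ box c (insert a s) n, F x =
      ∑ k ∈ interval (c a) n, ∑ y ∈ box c s n, F (y + Pi.single a k) := by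
  rw [← Finset.sum_product']
  symm
  refine Finset.sum_nbij' (fun p => p.2 + Pi.single a p.1)
    (fun x => (x a, Function.update x a 0)) ?_ ?_ ?_ ?_ fun _ _ => rfl
  · rintro ⟨k, y⟩ hp
    obtain ⟨hk, hy⟩ := Finset.mem_product.1 hp
    rw [box, Fintype.mem_piFinset] at hy ⊢
    intro i
    have hi := hy i
    by_cases hia : i = a
    · subst hia
      rw [if_neg ha, Finset.mem_singleton] at hi
      change y i = 0 at hi
      simpa [hi] using hk
    · simpa [hia] using hi
  · intro x hx
    rw [box, Fintype.mem_piFinset] at hx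
    refine Finset.mem_product.2 ⟨by simpa using hx a, ?_⟩
    rw [box, Fintype.mem_piFinset]
    intro i
    have hi := hx i
    by_cases hia : i = a
    · subst hia
      simp [ha]
    · simpa [hia] using hi
  · rintro ⟨k, y⟩ hp
    obtain ⟨hk, hy⟩ := Finset.mem_product.1 hp
    rw [box, Fintype.mem_piFinset] at hy
    have hi := hy a
    rw [if_neg ha, Finset.mem_singleton] at hi
    change y a = 0 at hi
    refine Prod.ext (by simp [hi]) ?_
    funext i
    by_cases hia : i = a
    · subst hia
      simp [hi]
    · simp [hia]
  · intro x _
    funext i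
    by_cases hia : i = a
    · subst hia
      simp
    · simp [hia]

/-- The average of `f` over the translations in a box. -/
noncomputable def boxAverage (τ : Site d → Ω → Ω) (f : Ω → ℝ) (c : Fin d → ℤ)
    (s : Finset (Fin d)) (n : ℕ) (ω : Ω) : ℝ :=
  ((box c s n).card : ℝ)⁻¹ * ∑ x ∈ box c s n, f (τ x ω)

variable {τ : Site d → Ω → Ω} {f : Ω → ℝ} {C : ℝ} {c : Fin d → ℤ}

omit [MeasurableSpace Ω] in
lemma boxAverage_insert (hadd : ∀ x y ω, τ (x + y) ω = τ x (τ y ω)) {s : Finset (Fin d)}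
    {a : Fin d} (ha : a ∉ s) (n : ℕ) (ω : Ω) :
    boxAverage τ f c (insert a s) n ω = ((interval (c a) n).card : ℝ)⁻¹ *
      ∑ k ∈ interval (c a) n, boxAverage τ f c s n (τ (Pi.single a k) ω) := by
  simp only [boxAverage]
  rw [sum_box_insert c ha, card_box, Finset.prod_insert ha, ← card_box, Nat.cast_mul, mul_inv,
    mul_assoc, ← Finset.mul_sum]
  simp only [hadd]

omit [MeasurableSpace Ω] in
lemma abs_boxAverage_le (hC : ∀ ω, |f ω| ≤ C) (s : Finset (Fin d)) (n : ℕ) (ω : Ω) :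
    |boxAverage τ f c s n ω| ≤ C :=
  abs_sum_div_card_le _ ((abs_nonneg _).trans (hC ω)) fun _ => hC _

omit [MeasurableSpace Ω] in
-- Peeling off direction `a` leaves a telescoping sum with two bounded terms, divided by the length
-- of the side. The convergence holds at every point, not just almost surely.
lemma tendsto_boxAverage_translate_sub (hadd : ∀ x y ω, τ (x + y) ω = τ x (τ y ω))
    (hC : ∀ ω, |f ω| ≤ C) (hc : ∀ i, c i = 0 ∨ c i = 1) {s : Finset (Fin d)} {a : Fin d}
    (ha : a ∈ s) (ω : Ω) : Tendsto (fun n => boxAverage τ f c s n (τ (Pi.single a 1) ω) -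
      boxAverage τ f c s n ω) atTop (𝓝 0) := by
  have hinv := (tendsto_inv_card_interval (hc a)).mul_const (C + C)
  rw [zero_mul] at hinv
  refine squeeze_zero_norm (fun n => ?_) hinv
  rw [← Finset.insert_erase ha, boxAverage_insert hadd (Finset.notMem_erase a s),
    boxAverage_insert hadd (Finset.notMem_erase a s), ← mul_sub]
  simp only [← hadd, ← Pi.single_add]
  rw [telescope_interval (fun k => boxAverage τ f c (s.erase a) n (τ (Pi.single a k) ω)) _ (hc a),
    Real.norm_eq_abs, abs_mul, abs_inv, Nat.abs_cast]
  refine mul_le_mul_of_nonneg_left ((abs_sub _ _).trans ?_) (by positivity)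
  exact add_le_add (abs_boxAverage_le hC _ _ _) (abs_boxAverage_le hC _ _ _)

lemma measurable_boxAverage (hτ : ∀ x, Measurable (τ x)) (hf : Measurable f)
    (s : Finset (Fin d)) (n : ℕ) : Measurable (boxAverage τ f c s n) :=
  (Finset.measurable_sum _ fun x _ => hf.comp (hτ x)).const_mul _

/-- The pointwise ergodic theorem for bounded functions and actions of `ℤ^d`. -/
theorem ae_exists_tendsto_boxAverage [IsProbabilityMeasure μ]
    (hτ : ∀ x, MeasurePreserving (τ x) μ μ) (h0 : τ 0 = id)
    (hadd : ∀ x y ω, τ (x + y) ω = τ x (τ y ω)) (hf : Measurable f) (hC : ∀ ω, |f ω| ≤ C)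
    (hc : ∀ i, c i = 0 ∨ c i = 1) (s : Finset (Fin d)) :
    ∀ᵐ ω ∂μ, ∃ r, Tendsto (fun n => boxAverage τ f c s n ω) atTop (𝓝 r) := by
  induction s using Finset.induction_on with
  | empty =>
    refine Eventually.of_forall fun ω => ⟨f ω, tendsto_const_nhds.congr fun n => ?_⟩
    have hb : box c ∅ n = {0} := by
      ext x
      simp [box, funext_iff]
    simp [boxAverage, hb, h0]
  | insert a s ha ih =>
    -- The integrand is the average over the directions in `s`. It depends on `n` and converges by
    -- induction, which is the situation of Maker's theorem.
    have := ae_exists_tendsto_intervalAverage (μ := μ) (θ := fun k => τ (Pi.single a k))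
      (fun k => hτ _) (by simp [h0]) (fun j k ω => by rw [Pi.single_add, hadd])
      (measurable_boxAverage (fun x => (hτ x).measurable) hf s)
      (fun n ω => abs_boxAverage_le hC s n ω) ih (hc a)
    simpa only [boxAverage_insert hadd ha] using this

end BoxAverage

/-! ### Rotations of the torus -/

section Torus

variable {d : ℕ}

/-- The cyclic permutation `k ↦ k + 1` of the integer interval `[lo, hi]`. -/
def cyclicShift (lo hi : ℤ) (h : lo ≤ hi) : Equiv.Perm ℤ where
  toFun k := if lo ≤ k ∧ k ≤ hi then (if k = hi then lo else k + 1) else k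
  invFun k := if lo ≤ k ∧ k ≤ hi then (if k = lo then hi else k - 1) else k
  left_inv k := by
    dsimp only
    split_ifs <;> omega
  right_inv k := by
    dsimp only
    split_ifs <;> omega

/-- The rotation of the box `Λ`, seen as a torus, by one step in direction `a`. -/
def Box.rotate (Λ : Box d) (a : Fin d) : Equiv.Perm (Site d) :=
  Equiv.piCongrRight fun i => if i = a then cyclicShift (Λ.lo i) (Λ.hi i) (Λ.lo_le_hi i)
    else Equiv.refl ℤ

lemma Box.mem_sites {Λ : Box d} {x : Site d} :
    x ∈ Λ.sites ↔ ∀ i, Λ.lo i ≤ x i ∧ x i ≤ Λ.hi i := by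
  simp only [Box.sites, Finset.mem_Icc, Pi.le_def, forall_and]

lemma Box.rotate_apply_self (Λ : Box d) (a : Fin d) (x : Site d) :
    Λ.rotate a x a = if Λ.lo a ≤ x a ∧ x a ≤ Λ.hi a then
      (if x a = Λ.hi a then Λ.lo a else x a + 1) else x a := by
  simp [Box.rotate, cyclicShift]

lemma Box.rotate_apply_of_ne (Λ : Box d) {a i : Fin d} (h : i ≠ a) (x : Site d) :
    Λ.rotate a x i = x i := by
  simp [Box.rotate, h]

lemma Box.rotate_mem_sites_iff (Λ : Box d) (a : Fin d) {x : Site d} :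
    Λ.rotate a x ∈ Λ.sites ↔ x ∈ Λ.sites := by
  rw [Box.mem_sites, Box.mem_sites]
  refine forall_congr' fun i => ?_
  by_cases h : i = a
  · subst h
    have := Λ.lo_le_hi i
    rw [Box.rotate_apply_self]
    split_ifs <;> omega
  · rw [Box.rotate_apply_of_ne _ h]

/-- The rotation is an automorphism of the torus graph. This needs `x` in the box: outside, `rotate`
can fix a point from which `next` steps into the box. -/
lemma Box.rotate_next (Λ : Box d) (a i : Fin d) {x : Site d} (hx : x ∈ Λ.sites) :
    Λ.rotate a (Λ.next x i) = Λ.next (Λ.rotate a x) i := by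
  have hi := Λ.lo_le_hi
  rw [Box.mem_sites] at hx
  funext j
  by_cases hja : j = a
  · subst hja
    by_cases hji : j = i
    · subst hji
      have h1 := hi j
      have h2 := hx j
      rw [Box.rotate_apply_self]
      simp only [Box.next, Function.update_self]
      rw [Box.rotate_apply_self]
      split_ifs <;> omega
    · rw [Box.rotate_apply_self]
      simp only [Box.next, Function.update_of_ne hji]
      rw [Box.rotate_apply_self]
  · rw [Box.rotate_apply_of_ne _ hja]
    by_cases hji : j = i
    · subst hji
      simp only [Box.next, Function.update_self]
      rw [Box.rotate_apply_of_ne _ hja]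
    · simp only [Box.next, Function.update_of_ne hji]
      rw [Box.rotate_apply_of_ne _ hja]

/-- The action on couplings of a map of the lattice. -/
def relabelCouplings (θ : Site d → Site d) (J : Couplings d) : Couplings d :=
  fun e => J (θ e.1, e.2)

/-- The action on sequences of replicas of a map of the lattice. -/
def relabelReplicas (θ : Site d → Site d) (σ : ℕ → Config d) : ℕ → Config d :=
  fun i x => σ i (θ x)

/-- The joint action on couplings and replicas of a map of the lattice. -/
def relabel (θ : Site d → Site d) : Couplings d × (ℕ → Config d) → Couplings d × (ℕ → Config d) :=
  Prod.map (relabelCouplings θ) (relabelReplicas θ)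

lemma measurable_relabelCouplings (θ : Site d → Site d) : Measurable (relabelCouplings θ) :=
  measurable_pi_iff.2 fun _ => measurable_pi_apply _

lemma measurable_relabelReplicas (θ : Site d → Site d) : Measurable (relabelReplicas θ) := by
  refine measurable_pi_iff.2 fun i => measurable_pi_iff.2 fun x => ?_
  exact (measurable_pi_apply (X := fun _ : Site d => ℤˣ) (θ x)).comp
    (measurable_pi_apply (X := fun _ : ℕ => Config d) i)

lemma measurable_relabel (θ : Site d → Site d) : Measurable (relabel θ) :=
  (measurable_relabelCouplings θ).prodMap (measurable_relabelReplicas θ)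

lemma measurePreserving_infinitePi_comp {ι X : Type*} [MeasurableSpace X] (P : Measure X)
    [IsProbabilityMeasure P] (e : Equiv.Perm ι) :
    MeasurePreserving (fun (x : ι → X) i => x (e i)) (Measure.infinitePi fun _ : ι => P)
      (Measure.infinitePi fun _ : ι => P) := by
  refine ⟨measurable_pi_iff.2 fun i => measurable_pi_apply _, ?_⟩
  have h := Measure.infinitePi_map_piCongrLeft (fun _ : ι => P) e.symm
  have hf : (fun (x : ι → X) i => x (e i)) =
      ⇑(MeasurableEquiv.piCongrLeft (fun _ : ι => X) e.symm) := by
    funext x i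
    have := Equiv.piCongrLeft_apply_apply (P := fun _ : ι => X) e.symm x (e i)
    rw [Equiv.symm_apply_apply] at this
    exact this.symm
  rw [hf]
  exact h

lemma measurePreserving_relabelCouplings (ν₀ : Measure ℝ) [IsProbabilityMeasure ν₀]
    (θ : Equiv.Perm (Site d)) :
    MeasurePreserving (relabelCouplings θ) (couplingLaw d ν₀) (couplingLaw d ν₀) :=
  measurePreserving_infinitePi_comp ν₀ (θ.prodCongr (Equiv.refl (Fin d)))

/-- The rotation permutes the terms, `(x, i)` going to `(Λ.rotate a x, i)`. The periodic boundary
conditions matter here: the wrapping edges are carried along together with their couplings. -/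
lemma hamiltonian_rotate (Λ : Box d) (a : Fin d) (J : Couplings d) (σ : Config d) :
    hamiltonian Λ (relabelCouplings (Λ.rotate a) J) (fun x => σ (Λ.rotate a x)) =
      hamiltonian Λ J σ := by
  unfold hamiltonian
  congr 1
  refine Finset.sum_equiv (Λ.rotate a) (fun x => (Box.rotate_mem_sites_iff Λ a).symm)
    fun x hx => Finset.sum_congr rfl fun i _ => ?_
  simp only [relabelCouplings, spin, Box.rotate_next Λ a i hx]

/-- The action of the rotation on configurations of the box. -/
def Box.rotateConfig (Λ : Box d) (a : Fin d) : (Λ.sites → ℤˣ) ≃ (Λ.sites → ℤˣ) :=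
  (Equiv.arrowCongr ((Λ.rotate a).subtypeEquiv fun _ => (Box.rotate_mem_sites_iff Λ a).symm)
    (Equiv.refl ℤˣ)).symm

lemma Box.extend_rotateConfig (Λ : Box d) (a : Fin d) (τ : Λ.sites → ℤˣ) :
    Λ.extend (Λ.rotateConfig a τ) = fun x => Λ.extend τ (Λ.rotate a x) := by
  funext x
  by_cases hx : x ∈ Λ.sites
  · have hx' := (Box.rotate_mem_sites_iff Λ a).2 hx
    simp only [Box.extend, dif_pos hx, dif_pos hx']
    rfl
  · have hx' := fun h => hx ((Box.rotate_mem_sites_iff Λ a).1 h)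
    simp only [Box.extend, dif_neg hx, dif_neg hx']

lemma gibbsWeight_rotate (β : ℝ) (Λ : Box d) (a : Fin d) (J : Couplings d) (τ : Λ.sites → ℤˣ) :
    gibbsWeight β Λ (relabelCouplings (Λ.rotate a) J) (Λ.rotateConfig a τ) =
      gibbsWeight β Λ J τ := by
  unfold gibbsWeight partitionFunction
  rw [Box.extend_rotateConfig, hamiltonian_rotate]
  congr 1
  refine (Fintype.sum_equiv (Λ.rotateConfig a) _ _ fun τ' => ?_).symm
  rw [Box.extend_rotateConfig, hamiltonian_rotate]

lemma gibbsMeasure_rotate (β : ℝ) (Λ : Box d) (a : Fin d) (J : Couplings d) :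
    gibbsMeasure β Λ (relabelCouplings (Λ.rotate a) J) =
      (gibbsMeasure β Λ J).map fun σ x => σ (Λ.rotate a x) := by
  have hm : Measurable fun (σ : Config d) x => σ (Λ.rotate a x) :=
    measurable_pi_iff.2 fun x => measurable_pi_apply _
  ext s hs
  rw [Measure.map_apply hm hs]
  simp only [gibbsMeasure, Measure.coe_finsetSum, Finset.sum_apply, Measure.smul_apply,
    smul_eq_mul, Measure.dirac_apply' _ hs, Measure.dirac_apply' _ (hm hs)]
  refine (Fintype.sum_equiv (Λ.rotateConfig a) _ _ fun τ => ?_).symm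
  rw [gibbsWeight_rotate, Box.extend_rotateConfig]
  rfl

lemma gibbsReplicas_rotate (β : ℝ) (Λ : Box d) (a : Fin d) (J : Couplings d) :
    gibbsReplicas β Λ (relabelCouplings (Λ.rotate a) J) =
      (gibbsReplicas β Λ J).map (relabelReplicas (Λ.rotate a)) := by
  have hm : Measurable fun (σ : Config d) x => σ (Λ.rotate a x) :=
    measurable_pi_iff.2 fun x => measurable_pi_apply _
  have h := Measure.infinitePi_map_pi (fun _ : ℕ => gibbsMeasure β Λ J) (fun _ => hm)
  change Measure.infinitePi (fun _ : ℕ => gibbsMeasure β Λ (relabelCouplings (Λ.rotate a) J)) =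
    (Measure.infinitePi (fun _ : ℕ => gibbsMeasure β Λ J)).map _
  simp only [gibbsMeasure_rotate]
  exact h.symm

/-- Covariance of the kernel and invariance of the base measure give invariance of the joint law; it
suffices to compare rectangles. -/
lemma measurePreserving_prodMap_compProd {α γ : Type*} [MeasurableSpace α] [MeasurableSpace γ]
    {ν : Measure α} [IsProbabilityMeasure ν] {K : Kernel α γ} [IsMarkovKernel K] {S : α → α}
    {R : γ → γ} (hS : MeasurePreserving S ν ν) (hR : Measurable R)
    (h : ∀ x, K (S x) = (K x).map R) :
    MeasurePreserving (Prod.map S R) (ν ⊗ₘ K) (ν ⊗ₘ K) := by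
  have hm := hS.measurable.prodMap hR
  have : IsProbabilityMeasure ((ν ⊗ₘ K).map (Prod.map S R)) :=
    Measure.isProbabilityMeasure_map hm.aemeasurable
  refine ⟨hm, Measure.ext_prod fun {s t} hs ht => ?_⟩
  rw [Measure.map_apply hm (hs.prod ht), Set.preimage_prod_map_prod,
    Measure.compProd_apply_prod (hS.measurable hs) (hR ht), Measure.compProd_apply_prod hs ht]
  have e : ∀ x, K x (R ⁻¹' t) = K (S x) t := fun x => by rw [h, Measure.map_apply hR ht]
  simp only [e]
  exact hS.setLIntegral_comp_preimage hs (K.measurable_coe ht)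

instance (β : ℝ) (Λ : Box d) : IsMarkovKernel (gibbsReplicas β Λ) := by
  unfold gibbsReplicas
  infer_instance

instance (κ : Kernel (Couplings d) (ProbabilityMeasure (Config d))) [IsMarkovKernel κ] :
    IsMarkovKernel (replicas κ) := by
  unfold replicas
  infer_instance

lemma measurePreserving_rotate (ν₀ : Measure ℝ) [IsProbabilityMeasure ν₀] (β : ℝ) (Λ : Box d)
    (a : Fin d) : MeasurePreserving (relabel (Λ.rotate a))
      (couplingLaw d ν₀ ⊗ₘ gibbsReplicas β Λ) (couplingLaw d ν₀ ⊗ₘ gibbsReplicas β Λ) :=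
  measurePreserving_prodMap_compProd (measurePreserving_relabelCouplings ν₀ (Λ.rotate a))
    (measurable_relabelReplicas _) (gibbsReplicas_rotate β Λ a)

end Torus

/-! ### Finite-dimensional distributions -/

section FiniteDimensional

variable {d : ℕ}

/-- The restriction to finitely many couplings and to finitely many replicas in a finite window. -/
def restrictTo (E : Finset (Edge d)) (W : Finset (Site d)) (s : ℕ)
    (ω : Couplings d × (ℕ → Config d)) : (E → ℝ) × (Fin s → W → ℤˣ) :=
  (E.restrict ω.1, fun i => W.restrict (ω.2 i))

lemma measurable_restrictTo (E : Finset (Edge d)) (W : Finset (Site d)) (s : ℕ) :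
    Measurable (restrictTo E W s) := by
  refine Measurable.prodMk (measurable_pi_iff.2 fun e => ?_)
    (measurable_pi_iff.2 fun i => measurable_pi_iff.2 fun x => ?_)
  · exact (measurable_pi_apply (X := fun _ : Edge d => ℝ) e.1).comp measurable_fst
  · exact ((measurable_pi_apply (X := fun _ : Site d => ℤˣ) x.1).comp
      (measurable_pi_apply (X := fun _ : ℕ => Config d) i)).comp measurable_snd

/-- The events that depend on finitely many couplings and on finitely many replicas in a finite
window. -/
def cylinderEvents (d : ℕ) : Set (Set (Couplings d × (ℕ → Config d))) :=
  {A | ∃ (E : Finset (Edge d)) (W : Finset (Site d)) (s : ℕ)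
    (B : Set ((E → ℝ) × (Fin s → W → ℤˣ))), MeasurableSet B ∧ A = restrictTo E W s ⁻¹' B}

lemma isPiSystem_cylinderEvents : IsPiSystem (cylinderEvents d) := by
  classical
  rintro _ ⟨E₁, W₁, s₁, B₁, hB₁, rfl⟩ _ ⟨E₂, W₂, s₂, B₂, hB₂, rfl⟩ -
  -- Any cylinder event can be described in a larger window, so two of them can be intersected in a
  -- common one.
  have key : ∀ {E E' : Finset (Edge d)} {W W' : Finset (Site d)} {s s' : ℕ} (hE : E ⊆ E')
      (hW : W ⊆ W') (hs : s ≤ s') (B : Set ((E → ℝ) × (Fin s → W → ℤˣ))), MeasurableSet B →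
      ∃ B' : Set ((E' → ℝ) × (Fin s' → W' → ℤˣ)), MeasurableSet B' ∧
        restrictTo E W s ⁻¹' B = restrictTo E' W' s' ⁻¹' B' := by
    intro E E' W W' s s' hE hW hs B hB
    let r : (E' → ℝ) × (Fin s' → W' → ℤˣ) → (E → ℝ) × (Fin s → W → ℤˣ) := fun p =>
      (fun e => p.1 ⟨e.1, hE e.2⟩, fun i x => p.2 (Fin.castLE hs i) ⟨x.1, hW x.2⟩)
    have hr : Measurable r := by
      refine Measurable.prodMk (measurable_pi_iff.2 fun e => ?_)
        (measurable_pi_iff.2 fun i => measurable_pi_iff.2 fun x => ?_)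
      · exact (measurable_pi_apply (X := fun _ : E' => ℝ) _).comp measurable_fst
      · exact ((measurable_pi_apply (X := fun _ : W' => ℤˣ) _).comp
          (measurable_pi_apply (X := fun _ : Fin s' => (W' → ℤˣ)) _)).comp measurable_snd
    exact ⟨r ⁻¹' B, hr hB, rfl⟩
  obtain ⟨B₁', h₁, e₁⟩ := key (Finset.subset_union_left (s₂ := E₂))
    (Finset.subset_union_left (s₂ := W₂)) (le_max_left s₁ s₂) B₁ hB₁
  obtain ⟨B₂', h₂, e₂⟩ := key (Finset.subset_union_right (s₁ := E₁))
    (Finset.subset_union_right (s₁ := W₁)) (le_max_right s₁ s₂) B₂ hB₂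
  refine ⟨E₁ ∪ E₂, W₁ ∪ W₂, max s₁ s₂, B₁' ∩ B₂', h₁.inter h₂, ?_⟩
  rw [e₁, e₂, Set.preimage_inter]

lemma generateFrom_cylinderEvents :
    (inferInstance : MeasurableSpace (Couplings d × (ℕ → Config d))) =
      MeasurableSpace.generateFrom (cylinderEvents d) := by
  refine le_antisymm (sup_le ?_ ?_) (MeasurableSpace.generateFrom_le ?_)
  · rw [← measurable_iff_comap_le]
    refine (@measurable_pi_iff _ _ _ (MeasurableSpace.generateFrom _) _ _).2 fun e B hB => ?_
    refine MeasurableSpace.measurableSet_generateFrom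
      ⟨{e}, ∅, 0, {p | p.1 ⟨e, Finset.mem_singleton_self e⟩ ∈ B}, ?_, rfl⟩
    exact ((measurable_pi_apply _).comp measurable_fst) hB
  · rw [← measurable_iff_comap_le]
    refine (@measurable_pi_iff _ _ _ (MeasurableSpace.generateFrom _) _ _).2 fun i => ?_
    refine (@measurable_pi_iff _ _ _ (MeasurableSpace.generateFrom _) _ _).2 fun x B hB => ?_
    refine MeasurableSpace.measurableSet_generateFrom
      -- Replica `i` is the last one among `0, …, i`, so `i + 1` replicas are kept.
      ⟨∅, {x}, i + 1, {p | p.2 (Fin.last i) ⟨x, Finset.mem_singleton_self x⟩ ∈ B}, ?_, ?_⟩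
    · exact (((measurable_pi_apply (X := fun _ : ({x} : Finset (Site d)) => ℤˣ) _).comp
        (measurable_pi_apply (X := fun _ : Fin (i + 1) => (({x} : Finset (Site d)) → ℤˣ)) _)).comp
          measurable_snd) hB
    · ext ω
      simp [restrictTo]
  · rintro _ ⟨E, W, s, B, hB, rfl⟩
    exact measurable_restrictTo E W s hB

instance (E : Finset (Edge d)) (W : Finset (Site d)) (s : ℕ) :
    BorelSpace ((E → ℝ) × (Fin s → W → ℤˣ)) := by
  have h1 : BorelSpace (E → ℝ) := Pi.borelSpace
  have h2 : BorelSpace (Fin s → W → ℤˣ) := Pi.borelSpace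
  exact Prod.borelSpace

lemma ext_of_forall_integral_restrictTo {P Q : Measure (Couplings d × (ℕ → Config d))}
    [IsProbabilityMeasure P] [IsProbabilityMeasure Q]
    (h : ∀ (E : Finset (Edge d)) (W : Finset (Site d)) (s : ℕ)
      (f : ((E → ℝ) × (Fin s → W → ℤˣ)) →ᵇ ℝ),
      ∫ ω, f (restrictTo E W s ω) ∂P = ∫ ω, f (restrictTo E W s ω) ∂Q) : P = Q := by
  refine ext_of_generate_finite (cylinderEvents d) generateFrom_cylinderEvents
    isPiSystem_cylinderEvents ?_ (by simp)
  rintro _ ⟨E, W, s, B, hB, rfl⟩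
  have hm := measurable_restrictTo E W s
  have hP : IsProbabilityMeasure (P.map (restrictTo E W s)) :=
    Measure.isProbabilityMeasure_map hm.aemeasurable
  have hQ : IsProbabilityMeasure (Q.map (restrictTo E W s)) :=
    Measure.isProbabilityMeasure_map hm.aemeasurable
  have key : P.map (restrictTo E W s) = Q.map (restrictTo E W s) := by
    refine ext_of_forall_integral_eq_of_IsFiniteMeasure fun f => ?_
    rw [integral_map hm.aemeasurable f.continuous.measurable.aestronglyMeasurable,
      integral_map hm.aemeasurable f.continuous.measurable.aestronglyMeasurable]
    exact h E W s f
  rw [← Measure.map_apply hm hB, key, Measure.map_apply hm hB]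

end FiniteDimensional

/-! ### Translation invariance of metastates -/

section Translation

variable {d : ℕ}

/-- The joint translation of couplings and replicas. -/
def translate (x : Site d) : Couplings d × (ℕ → Config d) → Couplings d × (ℕ → Config d) :=
  relabel (· + x)

lemma translate_zero : translate (0 : Site d) = id := by
  have h : (fun x : Site d => x + 0) = id := funext add_zero
  rw [translate, h]
  rfl

lemma translate_add (x y : Site d) (ω : Couplings d × (ℕ → Config d)) :
    translate (x + y) ω = translate x (translate y ω) := by
  have h : (fun z : Site d => z + (x + y)) = fun z => z + x + y :=
    funext fun z => (add_assoc z x y).symm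
  rw [translate, h]
  rfl

lemma Box.rotate_eq_add (Λ : Box d) (a : Fin d) {x : Site d} (hx : x ∈ Λ.sites)
    (hx' : x + Pi.single a 1 ∈ Λ.sites) : Λ.rotate a x = x + Pi.single a 1 := by
  rw [Box.mem_sites] at hx hx'
  funext i
  by_cases h : i = a
  · subst h
    have h1 := hx i
    have h2 := hx' i
    simp only [Pi.add_apply, Pi.single_eq_same] at h2 ⊢
    rw [Box.rotate_apply_self, if_pos h1, if_neg (by omega)]
  · rw [Box.rotate_apply_of_ne _ h]
    simp [h]

variable {ν₀ : Measure ℝ} [IsProbabilityMeasure ν₀] {β : ℝ} {Λ : ℕ → Box d}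
  {κ : Kernel (Couplings d) (ProbabilityMeasure (Config d))} [IsMarkovKernel κ]

/-- In finite volume the rotation preserves the law exactly. On the given window it agrees with the
translation once the box contains both the window and its translate, so the invariance passes to the
limit. -/
lemma measurePreserving_translate_single (hΛ : ExhaustsLattice Λ) (hκ : IsMetastate ν₀ β Λ κ)
    (a : Fin d) : MeasurePreserving (translate (Pi.single a 1))
      (couplingLaw d ν₀ ⊗ₘ replicas κ) (couplingLaw d ν₀ ⊗ₘ replicas κ) := by
  classical
  obtain ⟨φ, hφ, hlim⟩ := hκ
  have hm : Measurable (translate (d := d) (Pi.single a 1)) := measurable_relabel _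
  have hM : IsProbabilityMeasure
      ((couplingLaw d ν₀ ⊗ₘ replicas κ).map (translate (Pi.single a 1))) :=
    Measure.isProbabilityMeasure_map hm.aemeasurable
  refine ⟨hm, ext_of_forall_integral_restrictTo fun E W s f => ?_⟩
  have hfm : Measurable fun ω => f (restrictTo E W s ω) :=
    f.continuous.measurable.comp (measurable_restrictTo E W s)
  rw [integral_map hm.aemeasurable hfm.aestronglyMeasurable]
  -- A translated observable is a continuous function of the coordinates in the translated window,
  -- so the convergence hypothesis applies to it as well.
  let E' : Finset (Edge d) := E.image fun e => (e.1 + Pi.single a 1, e.2)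
  let W' : Finset (Site d) := W.image fun x => x + Pi.single a 1
  let r : (E' → ℝ) × (Fin s → W' → ℤˣ) → (E → ℝ) × (Fin s → W → ℤˣ) := fun p =>
    (fun e => p.1 ⟨(e.1.1 + Pi.single a 1, e.1.2), Finset.mem_image_of_mem _ e.2⟩,
      fun i x => p.2 i ⟨x.1 + Pi.single a 1, Finset.mem_image_of_mem _ x.2⟩)
  have hr : Continuous r := by fun_prop
  have hrr : ∀ ω, r (restrictTo E' W' s ω) = restrictTo E W s (translate (Pi.single a 1) ω) :=
    fun ω => rfl
  have h1 := hlim E' W' s (f.compContinuous ⟨r, hr⟩)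
  have h2 := hlim E W s f
  have h3 : ∀ᶠ k in atTop,
      ∫ ω, f (restrictTo E W s ω) ∂(couplingLaw d ν₀ ⊗ₘ gibbsReplicas β (Λ (φ k))) =
      ∫ ω, f (r (restrictTo E' W' s ω))
        ∂(couplingLaw d ν₀ ⊗ₘ gibbsReplicas β (Λ (φ k))) := by
    have hin : ∀ A : Finset (Site d), ∀ᶠ k in atTop, ∀ x ∈ A, x ∈ (Λ (φ k)).sites := fun A =>
      hφ.tendsto_atTop.eventually ((Finset.eventually_all A).2 fun x _ => hΛ x)
    filter_upwards [hin (E.image Prod.fst), hin (E'.image Prod.fst), hin W, hin W']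
      with k hE hE' hW hW'
    have hrot := measurePreserving_rotate ν₀ β (Λ (φ k)) a
    conv_lhs => rw [← hrot.map_eq]
    rw [integral_map hrot.measurable.aemeasurable hfm.aestronglyMeasurable]
    refine integral_congr_ae (Eventually.of_forall fun ω => ?_)
    simp only [hrr]
    congr 1
    refine Prod.ext (funext fun e => ?_) (funext fun i => funext fun x => ?_)
    · have := Box.rotate_eq_add (Λ (φ k)) a (hE _ (Finset.mem_image_of_mem Prod.fst e.2))
        (hE' _ (Finset.mem_image_of_mem Prod.fst (Finset.mem_image_of_mem _ e.2)))
      simp only [restrictTo, relabel, translate, relabelCouplings, Prod.map, Finset.restrict, this]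
    · have := Box.rotate_eq_add (Λ (φ k)) a (hW _ x.2) (hW' _ (Finset.mem_image_of_mem _ x.2))
      simp only [restrictTo, relabel, translate, relabelReplicas, Prod.map, Finset.restrict, this]
  exact tendsto_nhds_unique h1 (h2.congr' h3)

/-- The translations that preserve the law form a group, and the unit vectors generate `ℤ^d`. -/
lemma measurePreserving_translate (hΛ : ExhaustsLattice Λ) (hκ : IsMetastate ν₀ β Λ κ)
    (x : Site d) : MeasurePreserving (translate x)
      (couplingLaw d ν₀ ⊗ₘ replicas κ) (couplingLaw d ν₀ ⊗ₘ replicas κ) := by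
  set M := couplingLaw d ν₀ ⊗ₘ replicas κ with hM
  have hadd : ∀ x y, MeasurePreserving (translate x) M M → MeasurePreserving (translate y) M M →
      MeasurePreserving (translate (x + y)) M M := fun x y hx hy => by
    rw [show translate (x + y) = translate x ∘ translate y from funext (translate_add x y)]
    exact hx.comp hy
  have hneg : ∀ x, MeasurePreserving (translate x) M M → MeasurePreserving (translate (-x)) M M := by
    intro x hx
    refine ⟨measurable_relabel _, ?_⟩
    conv_lhs => rw [← hx.map_eq]
    rw [Measure.map_map (show Measurable (translate (-x)) from measurable_relabel _) hx.measurable]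
    have : translate (-x) ∘ translate x = id := by
      funext ω
      rw [Function.comp_apply, ← translate_add, neg_add_cancel, translate_zero]
    rw [this, Measure.map_id]
  have h0 : MeasurePreserving (translate (0 : Site d)) M M := by
    rw [translate_zero]
    exact MeasurePreserving.id M
  have hone := fun a => measurePreserving_translate_single hΛ hκ a
  have hsingle : ∀ a (k : ℤ), MeasurePreserving (translate (Pi.single a k)) M M := fun a k => by
    induction k using Int.induction_on with
    | zero => rwa [Pi.single_zero]
    | succ n ih => rw [Pi.single_add]; exact hadd _ _ ih (hone a)
    | pred n ih =>
      have hs : (Pi.single a (-1) : Site d) = -Pi.single a 1 := by rw [← Pi.single_neg]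
      rw [sub_eq_add_neg, Pi.single_add, hs]
      exact hadd _ _ ih (hneg _ (hone a))
  rw [← Finset.univ_sum_single x]
  refine Finset.sum_induction _ (fun y => MeasurePreserving (translate y) M M) hadd h0 ?_
  exact fun i _ => hsingle i _

end Translation

/-! ### Ergodicity of the couplings -/

section Ergodicity

variable {d : ℕ}

lemma iterate_relabelCouplings (a : Fin d) (N : ℕ) (J : Couplings d) :
    (relabelCouplings (· + Pi.single a 1))^[N] J = relabelCouplings (· + Pi.single a (N : ℤ)) J := by
  induction N with
  | zero =>
    funext e
    simp [relabelCouplings]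
  | succ N ih =>
    rw [Function.iterate_succ_apply', ih]
    funext e
    simp only [relabelCouplings, Nat.cast_succ, Pi.single_add, add_assoc]
    rw [add_comm (Pi.single a 1)]

lemma exists_disjoint_translate (E : Finset (Edge d)) (a : Fin d) :
    ∃ N : ℕ, ∀ e ∈ E, (e.1 + Pi.single a (N : ℤ), e.2) ∉ E := by
  set B : ℕ := ∑ e ∈ E, (e.1 a).natAbs with hB
  have hle : ∀ e ∈ E, (e.1 a).natAbs ≤ B := fun e he =>
    Finset.single_le_sum (f := fun e : Edge d => (e.1 a).natAbs) (fun _ _ => Nat.zero_le _) he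
  -- All coordinates in direction `a` lie in `[-B, B]`, so a shift by more than `2B` leaves this
  -- range.
  refine ⟨2 * B + 1, fun e he he' => ?_⟩
  have h1 := hle _ he
  have h2 := hle _ he'
  simp only [Pi.add_apply, Pi.single_eq_same] at h2
  omega

lemma measure_cylinder_inter_translate (ν₀ : Measure ℝ) [IsProbabilityMeasure ν₀]
    (E : Finset (Edge d)) {S : Set (E → ℝ)} (hS : MeasurableSet S) (x : Site d)
    (hx : ∀ e ∈ E, (e.1 + x, e.2) ∉ E) :
    couplingLaw d ν₀ (cylinder E S ∩ relabelCouplings (· + x) ⁻¹' cylinder E S) =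
      couplingLaw d ν₀ (cylinder E S) *
        couplingLaw d ν₀ (relabelCouplings (· + x) ⁻¹' cylinder E S) := by
  classical
  let E' : Finset (Edge d) := E.image fun e => (e.1 + x, e.2)
  have hdisj : Disjoint E E' := by
    rw [Finset.disjoint_left]
    intro e he he'
    obtain ⟨e₀, h0, rfl⟩ := Finset.mem_image.1 he'
    exact hx e₀ h0 he
  have hind : iIndepFun (fun (e : Edge d) (J : Couplings d) => J e) (couplingLaw d ν₀) :=
    iIndepFun_infinitePi (X := fun (_ : Edge d) (t : ℝ) => t) fun _ => measurable_id
  have h := hind.indepFun_finset E E' hdisj fun e => measurable_pi_apply e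
  let r : (E' → ℝ) → (E → ℝ) := fun p e =>
    p ⟨(e.1.1 + x, e.1.2), Finset.mem_image_of_mem _ e.2⟩
  have hr : Measurable r := measurable_pi_iff.2 fun e => measurable_pi_apply _
  exact h.measure_inter_preimage_eq_mul S (r ⁻¹' S) hS (hr hS)

/-- Independent couplings are ergodic under each translation of the lattice. -/
theorem ergodic_relabelCouplings (ν₀ : Measure ℝ) [IsProbabilityMeasure ν₀] (a : Fin d) :
    Ergodic (relabelCouplings (· + Pi.single a 1)) (couplingLaw d ν₀) := by
  set ν := couplingLaw d ν₀ with hν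
  have hmp : ∀ x : Site d, MeasurePreserving (relabelCouplings (· + x)) ν ν := fun x =>
    measurePreserving_relabelCouplings ν₀ (Equiv.addRight x)
  refine ⟨hmp _, ⟨fun A hA hinv => ?_⟩⟩
  -- An invariant event is independent of itself. It is approximated by a cylinder event `B`, and a
  -- far translate of `B`, independent of `B`, approximates it equally well. The errors are `ε/2`
  -- for `B ∩ T⁻¹' B` and `ε/2` for the squares, hence the choice `ε / 4`.
  have hsq : ν.real A = ν.real A * ν.real A := by
    refine eq_of_abs_sub_le_all fun ε hε => ?_
    have hdense := Measure.MeasureDense.of_generateFrom_isSetAlgebra_finite ν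
      isSetAlgebra_measurableCylinders generateFrom_measurableCylinders.symm
    obtain ⟨B, hB, hAB⟩ := hdense.approx A hA (measure_ne_top _ _) (ε / 4) (by positivity)
    have hBm := hdense.measurable B hB
    obtain ⟨E, S, hS, rfl⟩ := (mem_measurableCylinders B).1 hB
    obtain ⟨N, hN⟩ := exists_disjoint_translate E a
    set T : Couplings d → Couplings d := relabelCouplings (· + Pi.single a (N : ℤ)) with hT
    have hTmp : MeasurePreserving T ν ν := hmp _
    have hAT : T ⁻¹' A = A := by
      have hTN : T = (relabelCouplings (· + Pi.single a 1))^[N] :=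
        funext fun J => (iterate_relabelCouplings a N J).symm
      rw [hTN, Set.preimage_iterate_eq]
      exact Function.iterate_fixed hinv N
    set B : Set (Couplings d) := cylinder E S with hBdef
    have hδ : ν.real (symmDiff A B) ≤ ε / 4 :=
      ENNReal.toReal_le_of_le_ofReal (by positivity) hAB.le
    have hδ' : ν.real (symmDiff A (T ⁻¹' B)) ≤ ε / 4 := by
      have h1 : symmDiff A (T ⁻¹' B) = T ⁻¹' symmDiff A B := by
        rw [Set.preimage_symmDiff, hAT]
      rw [h1, measureReal_def, hTmp.measure_preimage (hA.symmDiff hBm).nullMeasurableSet]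
      exact hδ
    have hTB : ν.real (T ⁻¹' B) = ν.real B := by
      rw [measureReal_def, hTmp.measure_preimage hBm.nullMeasurableSet, measureReal_def]
    have hBB : ν.real (B ∩ T ⁻¹' B) = ν.real B * ν.real B := by
      have := measure_cylinder_inter_translate ν₀ E hS (Pi.single a (N : ℤ)) hN
      rw [measureReal_def, this, ENNReal.toReal_mul, ← hTB]
      simp only [measureReal_def, ← hν]
      rw [hTmp.measure_preimage hBm.nullMeasurableSet]
    have hmeas : |ν.real A - ν.real (B ∩ T ⁻¹' B)| ≤ ε / 4 + ε / 4 := by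
      refine (abs_measureReal_sub_le_measureReal_symmDiff hA.nullMeasurableSet
        (hBm.inter (hTmp.measurable hBm)).nullMeasurableSet).trans ?_
      have hsub : symmDiff A (B ∩ T ⁻¹' B) ⊆ symmDiff A B ∪ symmDiff A (T ⁻¹' B) := by
        intro J
        simp only [Set.mem_symmDiff, Set.mem_inter_iff, Set.mem_union]
        tauto
      exact (measureReal_mono hsub).trans ((measureReal_union_le _ _).trans (add_le_add hδ hδ'))
    have hAB' : |ν.real A - ν.real B| ≤ ε / 4 :=
      (abs_measureReal_sub_le_measureReal_symmDiff hA.nullMeasurableSet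
        hBm.nullMeasurableSet).trans hδ
    rw [hBB] at hmeas
    have hA1 : ν.real A ≤ 1 := measureReal_le_one
    have hB1 : ν.real B ≤ 1 := measureReal_le_one
    have hA0 : 0 ≤ ν.real A := measureReal_nonneg
    have hB0 : 0 ≤ ν.real B := measureReal_nonneg
    have h2 : |ν.real B * ν.real B - ν.real A * ν.real A| ≤ ε / 4 * 2 := by
      have e : ν.real B * ν.real B - ν.real A * ν.real A =
          -(ν.real A - ν.real B) * (ν.real A + ν.real B) := by ring
      rw [e, abs_mul, abs_neg, abs_of_nonneg (add_nonneg hA0 hB0)]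
      exact mul_le_mul hAB' (by linarith) (by linarith) (by positivity)
    calc |ν.real A - ν.real A * ν.real A|
        ≤ |ν.real A - ν.real B * ν.real B| + |ν.real B * ν.real B - ν.real A * ν.real A| :=
          abs_sub_le _ _ _
      _ ≤ ε := by linarith
  rw [eventuallyConst_set']
  have h01 : ν.real A = 0 ∨ ν.real A = 1 := by
    have : ν.real A * (ν.real A - 1) = 0 := by linarith
    rcases mul_eq_zero.1 this with h | h
    · exact Or.inl h
    · exact Or.inr (by linarith)
  rcases h01 with h | h
  · exact Or.inl (ae_eq_empty.2 ((measureReal_eq_zero_iff).1 h))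
  · refine Or.inr ?_
    rw [← Set.compl_empty, ← compl_compl A]
    refine EventuallyEq.compl (ae_eq_empty.2 ((measureReal_eq_zero_iff).1 ?_))
    rw [probReal_compl_eq_one_sub hA, h, sub_self]

variable {ν₀ : Measure ℝ} [IsProbabilityMeasure ν₀] {β : ℝ} {Λ : ℕ → Box d}
  {κ : Kernel (Couplings d) (ProbabilityMeasure (Config d))} [IsMarkovKernel κ]

/-- The conditional probability given the couplings of a translation-invariant event about the
replicas is almost surely constant. -/
theorem exists_ae_replicas_eq_const (hΛ : ExhaustsLattice Λ) (hκ : IsMetastate ν₀ β Λ κ)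
    (a : Fin d) {U : Set (ℕ → Config d)} (hU : MeasurableSet U)
    (hinv : ∀ᵐ ω ∂(couplingLaw d ν₀ ⊗ₘ replicas κ),
      relabelReplicas (· + Pi.single a 1) ω.2 ∈ U ↔ ω.2 ∈ U) :
    ∃ c, ∀ᵐ J ∂(couplingLaw d ν₀), replicas κ J U = c := by
  set ν := couplingLaw d ν₀ with hν
  set M := ν ⊗ₘ replicas κ with hM
  set T : Couplings d → Couplings d := relabelCouplings (· + Pi.single a 1) with hT
  have hTm : Measurable T := measurable_relabelCouplings _
  have hmp := measurePreserving_translate hΛ hκ (Pi.single a 1)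
  -- This is `B ↦ M(B × U)`, with density `J ↦ replicas κ J U` with respect to `ν`. It inherits
  -- invariance under `T` from that of `M` and of `U`.
  set m : Measure (Couplings d) := (M.restrict (Prod.snd ⁻¹' U)).map Prod.fst with hm
  have hmB : ∀ B, MeasurableSet B → m B = M (B ×ˢ U) := fun B hB => by
    rw [hm, Measure.map_apply measurable_fst hB, Measure.restrict_apply (measurable_fst hB),
      Set.prod_eq]
  have hmB' : ∀ B, MeasurableSet B → m B = ∫⁻ J in B, replicas κ J U ∂ν := fun B hB => by
    rw [hmB B hB, hM, Measure.compProd_apply_prod hB hU]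
  have hmT : MeasurePreserving T m m := by
    refine ⟨hTm, Measure.ext fun B hB => ?_⟩
    rw [Measure.map_apply hTm hB, hmB _ (hTm hB), hmB _ hB,
      ← hmp.measure_preimage (hB.prod hU).nullMeasurableSet]
    refine measure_congr ?_
    filter_upwards [hinv] with ω hω
    have : (ω ∈ (T ⁻¹' B) ×ˢ U) = (ω ∈ translate (Pi.single a 1) ⁻¹' (B ×ˢ U)) := by
      refine propext (and_congr Iff.rfl hω.symm)
    exact this
  have hac : m ≪ ν := by
    refine Measure.AbsolutelyContinuous.mk fun B hB h0 => ?_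
    rw [hmB' B hB, Measure.restrict_eq_zero.2 h0, lintegral_zero_measure]
  obtain ⟨c, hc⟩ := (ergodic_relabelCouplings ν₀ a).eq_smul_of_absolutelyContinuous hmT hac
  refine ⟨c, ae_eq_of_forall_setLIntegral_eq_of_sigmaFinite
    ((replicas κ).measurable_coe hU) measurable_const fun B hB _ => ?_⟩
  rw [← hmB' B hB, hc, setLIntegral_const]
  rfl

end Ergodicity

/-! ### Existence and translation invariance of the overlaps -/

section Overlap

variable {d : ℕ}

/-- The contribution to the edge overlap of the replicas `i`, `j` of the edge `{0, e_k}`. -/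
def edgeOverlap (i j : ℕ) (k : Fin d) (ω : Couplings d × (ℕ → Config d)) : ℝ :=
  spin (ω.2 i) 0 * spin (ω.2 i) (Pi.single k 1) * spin (ω.2 j) 0 * spin (ω.2 j) (Pi.single k 1)

lemma abs_spin (σ : Config d) (x : Site d) : |spin σ x| = 1 := by
  rcases Int.units_eq_one_or (σ x) with h | h <;> simp [spin, h]

lemma abs_edgeOverlap_le (i j : ℕ) (k : Fin d) (ω : Couplings d × (ℕ → Config d)) :
    |edgeOverlap i j k ω| ≤ 1 := by
  simp [edgeOverlap, abs_mul, abs_spin]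

lemma measurable_edgeOverlap (i j : ℕ) (k : Fin d) :
    Measurable (edgeOverlap (d := d) i j k) := by
  have h : ∀ i x, Measurable fun ω : Couplings d × (ℕ → Config d) => spin (ω.2 i) x := fun i x =>
    (measurable_spin x).comp
      ((measurable_pi_apply (X := fun _ : ℕ => Config d) i).comp measurable_snd)
  exact (((h _ _).mul (h _ _)).mul (h _ _)).mul (h _ _)

lemma edgeOverlap_translate (i j : ℕ) (k : Fin d) (x : Site d)
    (ω : Couplings d × (ℕ → Config d)) : edgeOverlap i j k (translate x ω) =
      spin (ω.2 i) x * spin (ω.2 i) (x + Pi.single k 1) * spin (ω.2 j) x *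
        spin (ω.2 j) (x + Pi.single k 1) := by
  rw [add_comm x]
  simp only [edgeOverlap, translate, relabel, relabelReplicas, Prod.map, spin, zero_add]

/-- An edge in direction `k` stays in the cube exactly if its base point has `k`-th coordinate at
most `n - 1`. This is why boxes with one shortened side occur. -/
lemma filter_cube (k : Fin d) (n : ℕ) :
    {x ∈ cube d n | x + Pi.single k 1 ∈ cube d n} = box (Pi.single k 1) Finset.univ n := by
  ext x
  simp only [cube, box, interval, Finset.mem_filter, Finset.mem_Icc, Pi.le_def,
    Fintype.mem_piFinset, Finset.mem_univ, if_true, Pi.add_apply, ← forall_and]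
  refine forall_congr' fun i => ?_
  by_cases h : i = k
  · subst h
    simp only [Pi.single_eq_same]
    omega
  · simp only [Pi.single_eq_of_ne h]
    omega

lemma sum_edgesIn_cube (n : ℕ) (F : Edge d → ℝ) :
    ∑ e ∈ edgesIn (cube d n), F e = ∑ k, ∑ x ∈ box (Pi.single k 1) Finset.univ n, F (x, k) := by
  rw [edgesIn, Finset.sum_filter, Finset.sum_product_right]
  refine Finset.sum_congr rfl fun k _ => ?_
  rw [← filter_cube, Finset.sum_filter]

lemma card_box_single (k k' : Fin d) (n : ℕ) :
    (box (Pi.single k 1) Finset.univ n).card = (box (Pi.single k' 1) Finset.univ n).card := by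
  have h : ∀ k : Fin d, (box (Pi.single k 1) Finset.univ n).card =
      (interval 1 n).card * (interval 0 n).card ^ (d - 1) := fun k => by
    rw [card_box, ← Finset.mul_prod_erase _ _ (Finset.mem_univ k), Pi.single_eq_same,
      Finset.prod_congr rfl fun i hi => by rw [Pi.single_eq_of_ne (Finset.ne_of_mem_erase hi)],
      Finset.prod_const, Finset.card_erase_of_mem (Finset.mem_univ k), Finset.card_univ,
      Fintype.card_fin]
  rw [h, h]

/-- Every direction contributes the same number of edges, so the overlap is the plain mean over
directions of box averages to which the ergodic theorem applies. -/
lemma windowOverlap_cube (i j n : ℕ) (ω : Couplings d × (ℕ → Config d)) :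
    windowOverlap (cube d n) (ω.2 i) (ω.2 j) = (d : ℝ)⁻¹ *
      ∑ k, boxAverage translate (edgeOverlap i j k) (Pi.single k 1) Finset.univ n ω := by
  rcases Nat.eq_zero_or_pos d with rfl | hd
  · simp [windowOverlap, sum_edgesIn_cube]
  obtain ⟨K, hK⟩ : ∃ K : ℕ, ∀ k : Fin d, (box (Pi.single k 1) Finset.univ n).card = K :=
    ⟨_, fun k => card_box_single k ⟨0, hd⟩ n⟩
  have hcard : ((edgesIn (cube d n)).card : ℝ) = d * K := by
    have h := sum_edgesIn_cube n (fun _ : Edge d => (1 : ℝ))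
    simp only [Finset.sum_const, nsmul_eq_mul, mul_one, hK, Finset.card_univ,
      Fintype.card_fin] at h
    exact h
  rw [windowOverlap, hcard, sum_edgesIn_cube, one_div, mul_inv, mul_assoc, Finset.mul_sum]
  congr 1
  refine Finset.sum_congr rfl fun k _ => ?_
  simp only [boxAverage, hK, edgeOverlap_translate]

lemma single_eq_zero_or_one (k i : Fin d) :
    (Pi.single k (1 : ℤ) : Fin d → ℤ) i = 0 ∨ (Pi.single k (1 : ℤ) : Fin d → ℤ) i = 1 := by
  by_cases h : i = k
  · subst h
    exact Or.inr (Pi.single_eq_same _ _)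
  · exact Or.inl (Pi.single_eq_of_ne h _)

variable {ν₀ : Measure ℝ} [IsProbabilityMeasure ν₀] {β : ℝ} {Λ : ℕ → Box d}
  {κ : Kernel (Couplings d) (ProbabilityMeasure (Config d))} [IsMarkovKernel κ]

theorem ae_hasOverlap (hΛ : ExhaustsLattice Λ) (hκ : IsMetastate ν₀ β Λ κ) :
    ∀ᵐ ω ∂(couplingLaw d ν₀ ⊗ₘ replicas κ), ∀ i j, HasOverlap (ω.2 i) (ω.2 j) := by
  refine ae_all_iff.2 fun i => ae_all_iff.2 fun j => ?_
  have h : ∀ᵐ ω ∂(couplingLaw d ν₀ ⊗ₘ replicas κ), ∀ k : Fin d, ∃ r,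
      Tendsto (fun n => boxAverage translate (edgeOverlap i j k) (Pi.single k 1) Finset.univ n ω)
        atTop (𝓝 r) :=
    ae_all_iff.2 fun k => ae_exists_tendsto_boxAverage (measurePreserving_translate hΛ hκ)
      translate_zero translate_add (measurable_edgeOverlap i j k) (abs_edgeOverlap_le i j k)
      (single_eq_zero_or_one k) Finset.univ
  filter_upwards [h] with ω hω
  choose r hr using hω
  refine ⟨(d : ℝ)⁻¹ * ∑ k, r k, ?_⟩
  simp only [windowOverlap_cube]
  exact (tendsto_finsetSum _ fun k _ => hr k).const_mul _

/-- The window overlaps before and after translation differ by a quantity tending to zero, so they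
share their limit. -/
lemma overlap_translate (a : Fin d) (ω : Couplings d × (ℕ → Config d)) (i j : ℕ)
    (h : HasOverlap (ω.2 i) (ω.2 j)) :
    overlapMatrix (relabelReplicas (· + Pi.single a 1) ω.2) i j = overlapMatrix ω.2 i j := by
  obtain ⟨r, hr⟩ := h
  have hdiff : Tendsto (fun n => windowOverlap (cube d n) ((translate (Pi.single a 1) ω).2 i)
      ((translate (Pi.single a 1) ω).2 j) - windowOverlap (cube d n) (ω.2 i) (ω.2 j))
      atTop (𝓝 0) := by
    simp only [windowOverlap_cube, ← mul_sub, ← Finset.sum_sub_distrib]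
    have := tendsto_finsetSum Finset.univ fun (k : Fin d) _ =>
      tendsto_boxAverage_translate_sub (τ := translate) (f := edgeOverlap i j k)
        (c := Pi.single k 1) translate_add (abs_edgeOverlap_le i j k) (single_eq_zero_or_one k)
        (Finset.mem_univ a) ω
    simpa using this.const_mul (d : ℝ)⁻¹
  have hr' := hdiff.add hr
  simp only [sub_add_cancel, zero_add] at hr'
  change limUnder atTop _ = limUnder atTop _
  rw [hr.limUnder_eq]
  exact hr'.limUnder_eq

/-- The law of the overlaps given the couplings is almost surely equal to its average. -/
theorem ae_rost_eq_averagedRost (hd : 1 ≤ d) (hΛ : ExhaustsLattice Λ)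
    (hκ : IsMetastate ν₀ β Λ κ) :
    ∀ᵐ J ∂(couplingLaw d ν₀), rost κ J = averagedRost ν₀ κ := by
  have hmk : IsMarkovKernel (rost κ) := Kernel.IsMarkovKernel.map _ measurable_overlapMatrix
  have hconst : ∀ t, MeasurableSet t → ∀ᵐ J ∂(couplingLaw d ν₀),
      rost κ J t = averagedRost ν₀ κ t := fun t ht => by
    have hU := measurable_overlapMatrix (d := d) ht
    obtain ⟨c, hc⟩ := exists_ae_replicas_eq_const hΛ hκ ⟨0, hd⟩ hU (by
      filter_upwards [ae_hasOverlap hΛ hκ] with ω hω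
      have : overlapMatrix (relabelReplicas (· + Pi.single ⟨0, hd⟩ 1) ω.2) = overlapMatrix ω.2 :=
        funext fun i => funext fun j => overlap_translate ⟨0, hd⟩ ω i j (hω i j)
      rw [Set.mem_preimage, Set.mem_preimage, this])
    have hrc : ∀ᵐ J ∂(couplingLaw d ν₀), rost κ J t = c := by
      filter_upwards [hc] with J hJ
      rw [rost, Kernel.map_apply' _ measurable_overlapMatrix _ ht, hJ]
    have havg : averagedRost ν₀ κ t = c := by
      rw [averagedRost, Measure.bind_apply ht (rost κ).aemeasurable, lintegral_congr_ae hrc]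
      simp
    rw [havg]
    exact hrc
  have hP : IsProbabilityMeasure (averagedRost ν₀ κ) := by
    unfold averagedRost
    infer_instance
  -- The exceptional null set in `hconst` depends on `t`. Comparing joint laws on rectangles, and
  -- then disintegrating, yields one null set for all `t`.
  have key : couplingLaw d ν₀ ⊗ₘ rost κ =
      couplingLaw d ν₀ ⊗ₘ Kernel.const (Couplings d) (averagedRost ν₀ κ) := by
    refine Measure.ext_prod fun {s t} hs ht => ?_
    rw [Measure.compProd_apply_prod hs ht, Measure.compProd_apply_prod hs ht]
    exact lintegral_congr_ae (ae_restrict_of_ae (hconst t ht))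
  exact Kernel.ae_eq_of_compProd_eq key

end Overlap

/-! ### The overlap matrix is a random overlap structure -/

section ROSt

variable {d : ℕ}

lemma edgesIn_cube_nonempty (hd : 1 ≤ d) {n : ℕ} (hn : 1 ≤ n) : (edgesIn (cube d n)).Nonempty := by
  refine ⟨(0, ⟨0, hd⟩), ?_⟩
  simp only [edgesIn, cube, Finset.mem_filter, Finset.mem_product, Finset.mem_Icc, Pi.le_def,
    Finset.mem_univ, and_true, Pi.add_apply, Pi.zero_apply, zero_add]
  refine ⟨⟨fun i => by omega, fun i => by omega⟩, ?_⟩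
  have h := single_eq_zero_or_one (⟨0, hd⟩ : Fin d)
  exact ⟨fun i => by have := h i; omega, fun i => by have := h i; omega⟩

lemma overlap_self (hd : 1 ≤ d) (σ : Config d) : overlap σ σ = 1 := by
  refine Tendsto.limUnder_eq (tendsto_const_nhds.congr' ?_)
  -- For `n = 0` the cube is a single site without edges, and its window overlap is `0`.
  filter_upwards [eventually_ge_atTop 1] with n hn
  have hcard : ((edgesIn (cube d n)).card : ℝ) ≠ 0 := by
    exact_mod_cast (edgesIn_cube_nonempty hd hn).card_pos.ne'
  have hsq : ∀ x, spin σ x * spin σ x = 1 := fun x => by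
    rw [← abs_mul_abs_self, abs_spin, one_mul]
  have h1 : ∀ e ∈ edgesIn (cube d n), spin σ e.1 * spin σ (e.1 + Pi.single e.2 1) *
      spin σ e.1 * spin σ (e.1 + Pi.single e.2 1) = 1 := fun e _ => by
    rw [mul_right_comm (spin σ e.1), hsq, one_mul, hsq]
  rw [windowOverlap, Finset.sum_congr rfl h1, Finset.sum_const, nsmul_eq_mul, mul_one,
    one_div, inv_mul_cancel₀ hcard]

lemma windowOverlap_comm (W : Finset (Site d)) (σ σ' : Config d) :
    windowOverlap W σ σ' = windowOverlap W σ' σ := by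
  unfold windowOverlap
  congr 1
  exact Finset.sum_congr rfl fun e _ => by ring

/-- The window overlap is a normalised inner product of the vectors of edge products `σ_x σ_y`, so
the quadratic form is a sum of squares over edges. -/
lemma sum_windowOverlap_nonneg (W : Finset (Site d)) (σ : ℕ → Config d) (s : Finset ℕ)
    (x : ℕ → ℝ) : 0 ≤ ∑ i ∈ s, ∑ j ∈ s, x i * windowOverlap W (σ i) (σ j) * x j := by
  have h : ∑ i ∈ s, ∑ j ∈ s, x i * windowOverlap W (σ i) (σ j) * x j =
      1 / ((edgesIn W).card : ℝ) * ∑ e ∈ edgesIn W,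
        (∑ i ∈ s, x i * (spin (σ i) e.1 * spin (σ i) (e.1 + Pi.single e.2 1))) ^ 2 := by
    simp only [windowOverlap, sq, Finset.mul_sum, Finset.sum_mul]
    rw [Finset.sum_comm]
    refine (Finset.sum_congr rfl fun i _ => Finset.sum_comm).trans ?_
    rw [Finset.sum_comm]
    refine Finset.sum_congr rfl fun e _ => ?_
    rw [Finset.sum_comm]
    exact Finset.sum_congr rfl fun i _ => Finset.sum_congr rfl fun j _ => by ring
  rw [h]
  positivity

lemma posSemidef_overlapMatrix {σ : ℕ → Config d} (h : ∀ i j, HasOverlap (σ i) (σ j)) :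
    (Matrix.of (overlapMatrix σ)).PosSemidef := by
  have hlim : ∀ i j, Tendsto (fun n => windowOverlap (cube d n) (σ i) (σ j)) atTop
      (𝓝 (overlapMatrix σ i j)) := fun i j => tendsto_nhds_limUnder (h i j)
  refine ⟨Matrix.IsHermitian.ext fun i j => ?_, fun x => ?_⟩
  · simp only [Matrix.of_apply, star_trivial]
    refine tendsto_nhds_unique (hlim j i) ?_
    simpa only [windowOverlap_comm _ (σ j) (σ i)] using hlim i j
  · simp only [Finsupp.sum, Matrix.of_apply, star_trivial]
    refine ge_of_tendsto' (tendsto_finsetSum _ fun i _ => tendsto_finsetSum _ fun j _ =>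
      ((hlim i j).const_mul (x i)).mul_const (x j)) fun n => ?_
    exact sum_windowOverlap_nonneg (cube d n) σ x.support x

/-- Closedness gives the measurability needed to transfer positivity from the replicas to the law of
their overlap matrix. -/
lemma isClosed_posSemidef : IsClosed {q : ℕ → ℕ → ℝ | (Matrix.of q).PosSemidef} := by
  have e : {q : ℕ → ℕ → ℝ | (Matrix.of q).PosSemidef} =
      {q | ∀ i j, q j i = q i j} ∩
        {q | ∀ x : ℕ →₀ ℝ, 0 ≤ ∑ i ∈ x.support, ∑ j ∈ x.support, x i * q i j * x j} := by
    ext q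
    exact and_congr (Matrix.IsHermitian.ext_iff.trans (by simp)) (by simp [Finsupp.sum])
  have hc : ∀ i j, Continuous fun q : ℕ → ℕ → ℝ => q i j := fun i j => by fun_prop
  rw [e, Set.ofPred_forall, Set.ofPred_forall]
  refine (isClosed_iInter fun i => ?_).inter (isClosed_iInter fun x => ?_)
  · rw [Set.ofPred_forall]
    exact isClosed_iInter fun j => isClosed_eq (hc _ _) (hc _ _)
  · exact isClosed_le continuous_const (by fun_prop)

variable {κ : Kernel (Couplings d) (ProbabilityMeasure (Config d))}

/-- Given `Γ` the replicas are i.i.d., and a mixture of exchangeable laws is exchangeable. -/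
lemma measurePreserving_replicas_perm (J : Couplings d) (π : Equiv.Perm ℕ) :
    MeasurePreserving (fun (σ : ℕ → Config d) i => σ (π i)) (replicas κ J) (replicas κ J) := by
  have hm : Measurable fun (σ : ℕ → Config d) i => σ (π i) :=
    measurable_pi_iff.2 fun i => measurable_pi_apply _
  refine ⟨hm, Measure.ext fun U hU => ?_⟩
  rw [Measure.map_apply hm hU, replicas, Kernel.comp_apply' _ _ _ (hm hU),
    Kernel.comp_apply' _ _ _ hU]
  refine lintegral_congr fun Γ => ?_
  exact (measurePreserving_infinitePi_comp (Γ : Measure (Config d)) π).measure_preimage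
    hU.nullMeasurableSet

theorem isROSt_rost [IsMarkovKernel κ] (hd : 1 ≤ d) (J : Couplings d)
    (h : ∀ᵐ σ ∂(replicas κ J), ∀ i j, HasOverlap (σ i) (σ j)) : IsROSt (rost κ J) := by
  have hr : rost κ J = (replicas κ J).map overlapMatrix :=
    Kernel.map_apply _ measurable_overlapMatrix J
  have hm := measurable_overlapMatrix (d := d)
  refine ⟨?_, ?_, ?_, fun π _ => ?_⟩
  · rw [hr]
    exact Measure.isProbabilityMeasure_map hm.aemeasurable
  · rw [hr]
    refine ae_all_iff.2 fun i => (ae_map_iff hm.aemeasurable ?_).2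
      (Eventually.of_forall fun σ => overlap_self hd (σ i))
    exact (isClosed_eq (by fun_prop) continuous_const).measurableSet
  · rw [hr]
    refine (ae_map_iff hm.aemeasurable isClosed_posSemidef.measurableSet).2 ?_
    filter_upwards [h] with σ hσ using posSemidef_overlapMatrix hσ
  · have hπ : Measurable fun (q : ℕ → ℕ → ℝ) i j => q (π i) (π j) := by fun_prop
    have hp := measurePreserving_replicas_perm (κ := κ) J π
    rw [hr, Measure.map_map hπ hm]
    conv_rhs => rw [← hp.map_eq, Measure.map_map hm hp.measurable]
    rfl

end ROSt

end EdwardsAnderson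

/-- In the Edwards-Anderson model with periodic boundary conditions, the limiting edge overlaps
exist almost surely, and the random overlap structure `Q_J` built from a metastate `κ_J` has, for
`ν`-almost every `J`, the same law as its `ν`-average `Q`. -/
theorem mainTheorem3 (d : ℕ) (hd : 1 ≤ d)
    (ν₀ : Measure ℝ) [IsProbabilityMeasure ν₀] (hsymm : ν₀.map (fun t => -t) = ν₀)
    (β : ℝ) (Λ : ℕ → EdwardsAnderson.Box d) (hΛ : EdwardsAnderson.ExhaustsLattice Λ)
    (κ : Kernel (EdwardsAnderson.Couplings d)
      (ProbabilityMeasure (EdwardsAnderson.Config d))) [IsMarkovKernel κ]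
    (hκ : EdwardsAnderson.IsMetastate ν₀ β Λ κ) :
    EdwardsAnderson.IsROSt (EdwardsAnderson.averagedRost ν₀ κ) ∧
    ∀ᵐ J ∂(EdwardsAnderson.couplingLaw d ν₀),
      (∀ᵐ σ ∂(EdwardsAnderson.replicas κ J), ∀ i j, EdwardsAnderson.HasOverlap (σ i) (σ j)) ∧
      EdwardsAnderson.IsROSt (EdwardsAnderson.rost κ J) ∧
      EdwardsAnderson.rost κ J = EdwardsAnderson.averagedRost ν₀ κ := by
  have key : ∀ᵐ J ∂(EdwardsAnderson.couplingLaw d ν₀),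
      (∀ᵐ σ ∂(EdwardsAnderson.replicas κ J), ∀ i j, EdwardsAnderson.HasOverlap (σ i) (σ j)) ∧
      EdwardsAnderson.IsROSt (EdwardsAnderson.rost κ J) ∧
      EdwardsAnderson.rost κ J = EdwardsAnderson.averagedRost ν₀ κ := by
    filter_upwards [Measure.ae_ae_of_ae_compProd (EdwardsAnderson.ae_hasOverlap hΛ hκ),
      EdwardsAnderson.ae_rost_eq_averagedRost hd hΛ hκ] with J h1 h2
    exact ⟨h1, EdwardsAnderson.isROSt_rost hd J h1, h2⟩
  -- The averaged law coincides with the law of `Q_J` for some good `J`, and so inherits its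
  -- properties.
  obtain ⟨J, -, h1, h2⟩ := key.exists
  exact ⟨h2 ▸ h1, key⟩
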